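/- **Setting.** Let $G$ be a complex Lie group with reductive Lie algebra $\mathfrak g$, with a fixed nondegenerate symmetric invariant bilinear form $(\cdot,\cdot)$; let $\mathfrak t\subset\mathfrak g$ be a Cartan subalgebra with roots $\Phi\subset\mathfrak t^*$. Let $\lambda\in\mathfrak t$, let $\mathfrak h$ be the centralizer of $\lambda$, and $\mathfrak g_1=[\mathfrak h,\mathfrak h]$ (so $\mathfrak h=\mathfrak g_1+\mathfrak t$ with $\mathfrak g_1$ semisimple). Let $G_1$ be the connected complex Lie group integrating $\mathfrak g_1\subset\mathfrak g$, with its homomorphism to $G$. Let $\Phi_+\subset\Phi$ be a system of positive roots for which there is $\theta\in\mathbb C$ with $\operatorname{Im}(\alpha(\lambda)/\theta)>0$ for all $\alpha\in\Phi_+$ with $\alpha(\lambda)\ne0$. For root vectors $e_\alpha$, $\alpha\in\Phi$, with $(e_\alpha,e_{-\alpha})=1$, put $$r_{\mathfrak g}=\sum_{\alpha\in\Phi_+}e_\alpha\wedge e_{-\alpha},\qquad r_{\mathfrak g_1}=\sum_{\alpha\in\Phi_+,\ \alpha(\lambda)=0}e_\alpha\wedge e_{-\alpha},\qquad a\wedge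 b=\tfrac12(a\otimes b-b\otimes a).$$ Let $\Omega\in S^2(\mathfrak g)^{\mathfrak g}$ be the Casimir element, $x^\vee=(x\otimes\mathrm{id})(\Omega)$ for $x\in\mathfrak g^*$, and $\phi(z)=-\frac1z+\frac12\coth\frac z2$ (so $\phi(0)=0$). The Alekseev–Meinrenken $r$-matrix is $r_{\mathrm{AM},\mathfrak g}(x)=(\mathrm{id}\otimes\phi(\mathrm{ad}_{x^\vee}))(\Omega)$, defined when no eigenvalue of $\mathrm{ad}_{x^\vee}$ lies in $2\pi i(\mathbb Z\setminus\{0\})$; $r_{\mathrm{AM},\mathfrak g_1}$ is defined likewise on $\mathfrak g_1^*$ with the restricted form. Let $p:\mathfrak g^*\to\mathfrak g_1^*$ be the restriction of functionals to $\mathfrak g_1$ (equivalently, the orthogonal projection $\mathfrak g\to\mathfrak g_1$). For a complex Lie group $K$ with Lie algebra $\mathfrak k$, a holomorphic map $\rho$ from an open subset of $\mathfrak k^*$ to $K$, and $r\in\mathfrak k\otimes\mathfrak k$, put $$r^\rho=\rho_1^{-1}d_2(\rho_1)-\rho_2^{-1}d_1(\rho_2)+(\otimes^2\mathrm{Ad}_\rho)^{-1}(r)-\langle\mathrm{id}\otimes\mathrm{id}\otimes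 x,[\rho_1^{-1}d_3(\rho_1),\rho_2^{-1}d_3(\rho_2)]\rangle ,$$ that is, for a basis $(e_i)$ of $\mathfrak k$ with dual basis $(e^i)$ and $\delta_i=\rho^{-1}\partial_{e^i}\rho\,(x)\in\mathfrak k$, $$r^\rho(x)=\sum_i(\delta_i\otimes e_i-e_i\otimes\delta_i)+(\otimes^2\mathrm{Ad}_{\rho(x)})^{-1}(r)-\sum_{i,j}\langle x,[e_i,e_j]\rangle\,\delta_i\otimes\delta_j .$$ Let $D\subset\mathfrak g^*$ be any open subset on which $r_{\mathrm{AM},\mathfrak g}$ and $r_{\mathrm{AM},\mathfrak g_1}\circ p$ are defined (for instance the largest one, which is dense). A *relative Ginzburg–Weinstein twist* on $D$ for $\mathfrak g_1\subset\mathfrak g$ is a holomorphic map $C:D\to G$ such that on $D$ $$r_{\mathrm{AM},\mathfrak g}-(\otimes^2\mathrm{Ad}_{C^{-1}})(r_{\mathrm{AM},\mathfrak g_1}\circ p)=(r_{\mathfrak g}-r_{\mathfrak g_1})^{C},$$ $C$ is $\mathfrak h$-equivariant (infinitesimally, for the coadjoint action on $\mathfrak g^*$ and conjugation on $G$), and $C(x)=1$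 for all $x\in D$ with $x^\vee\in\mathfrak g_1$. **Proposition.** Let $C$ be a relative Ginzburg–Weinstein twist on $D$ for $\mathfrak g_1\subset\mathfrak g$, and let $\rho_{\mathfrak g_1}:p(D)\to G_1$ be holomorphic. Then $$r_{\mathfrak g_1}^{\rho_{\mathfrak g_1}}=r_{\mathrm{AM},\mathfrak g_1}\ \text{ on } p(D)$$ if and only if the pointwise product $\rho=\rho_{\mathfrak g_1}\cdot C:D\to G$, $\rho(x)=\rho_{\mathfrak g_1}(p(x))\,C(x)$ (with $G_1$ mapped to $G$), satisfies $$r_{\mathfrak g}^{\rho}=r_{\mathrm{AM},\mathfrak g}\ \text{ on } D .$$ -/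

import Mathlib

open scoped Manifold ContDiff TensorProduct

noncomputable section

namespace GWTwist

/-! ### Algebra: Cartan data, Casimir element, r-matrices -/

section Algebra

variable {L : Type*} [LieRing L] [LieAlgebra ℂ L]

/-- A nondegenerate symmetric invariant bilinear form (the fixed "inner product" on `L`). -/
structure IsInvariantForm (B : LinearMap.BilinForm ℂ L) : Prop where
  symm : ∀ x y, B x y = B y x
  nondegenerate : B.Nondegenerate
  invariant : ∀ x y z, B ⁅x, y⁆ z = B x ⁅y, z⁆

/-- The roots of `L` with respect to a Cartan subalgebra `t`. -/
def roots (t : LieSubalgebra ℂ L) [t.IsCartanSubalgebra] : Set (Module.Dual ℂ t) :=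
  {α | α ≠ 0 ∧ LieAlgebra.rootSpace t (⇑α) ≠ ⊥}

/-- `P` is a system of positive roots. -/
structure IsPositiveSystem (t : LieSubalgebra ℂ L) [t.IsCartanSubalgebra]
    (P : Finset (Module.Dual ℂ t)) : Prop where
  subset_roots : ∀ α ∈ P, α ∈ roots t
  pos_or_neg : ∀ α ∈ roots t, α ∈ P ∨ -α ∈ P
  not_both : ∀ α ∈ P, -α ∉ P
  add_mem : ∀ α ∈ P, ∀ β ∈ P, α + β ∈ roots t → α + β ∈ P

/-- A choice of root vectors: `e α` spans the root line of the root `α`, and the choice is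
normalised by `B (e α) (e (-α)) = 1`. -/
structure IsRootVectors (B : LinearMap.BilinForm ℂ L) (t : LieSubalgebra ℂ L)
    [t.IsCartanSubalgebra] (e : Module.Dual ℂ t → L) : Prop where
  span_eq : ∀ α ∈ roots t, Submodule.span ℂ {e α} = (LieAlgebra.rootSpace t (⇑α)).toSubmodule
  norm_eq : ∀ α ∈ roots t, B (e α) (e (-α)) = 1

/-- `a ∧ b = (a ⊗ b - b ⊗ a) / 2`, the skew-symmetric part of `a ⊗ b`. -/
def wedge (a b : L) : L ⊗[ℂ] L := (1 / 2 : ℂ) • (a ⊗ₜ[ℂ] b - b ⊗ₜ[ℂ] a)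

/-- `∑_{α ∈ P} e_α ∧ e_{-α}`: the skew-symmetric part of the standard classical r-matrix
`∑_{α ∈ P} e_α ⊗ e_{-α} + (1/2) ∑_j t_j ⊗ t^j`. -/
def standardR {V : Type*} [AddCommGroup V] (P : Finset V) (e : V → L) : L ⊗[ℂ] L :=
  ∑ α ∈ P, wedge (e α) (e (-α))

open Classical in
/-- The positive roots vanishing on `lam`, i.e. those of the centralizer of `lam`. -/
def leviPos {t : LieSubalgebra ℂ L} (P : Finset (Module.Dual ℂ t)) (lam : t) :
    Finset (Module.Dual ℂ t) :=
  P.filter fun α => α lam = 0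

/-- The Levi subalgebra `𝔥`: the centralizer of `lam`. -/
def levi (lam : L) : Submodule ℂ L := LinearMap.ker (LieAlgebra.ad ℂ L lam)

/-- The semisimple part `𝔤₁ = [𝔥, 𝔥]` of the Levi subalgebra `𝔥`. -/
def leviDerived (lam : L) : Submodule ℂ L :=
  Submodule.span ℂ {z | ∃ u ∈ levi lam, ∃ v ∈ levi lam, ⁅u, v⁆ = z}

variable [FiniteDimensional ℂ L]

open Classical in
/-- The Casimir element `Ω = ∑ bⁱ ⊗ bᵢ` of a nondegenerate bilinear form, where `(bᵢ)` is a basis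
and `(bⁱ)` its dual basis with respect to the form (junk value `0` for a degenerate form). -/
def casimir (B : LinearMap.BilinForm ℂ L) : L ⊗[ℂ] L :=
  if h : B.Nondegenerate then
    ∑ i, (B.dualBasis h (Module.finBasis ℂ L) i) ⊗ₜ[ℂ] (Module.finBasis ℂ L i)
  else 0

/-- `x^∨ = (x ⊗ id)(Ω)`. -/
def sharp (B : LinearMap.BilinForm ℂ L) (x : Module.Dual ℂ L) : L :=
  TensorProduct.lid ℂ L (TensorProduct.map x LinearMap.id (casimir B))

/-- `φ(z) = -1/z + (1/2) coth(z/2)`. At the removable singularity `z = 0`, where `φ` has the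
limit `0`, the convention `1 / 0 = 0` gives the value `0`. -/
def phi (z : ℂ) : ℂ := -(1 / z) + (1 / 2) * (Complex.cosh (z / 2) / Complex.sinh (z / 2))

/-- `S = f(T)` in the holomorphic functional calculus: `S = p(T)` for a polynomial `p` that has
the same Taylor coefficients of order `< dim V` as `f` at every eigenvalue of `T`. -/
def IsFunCalc {V : Type*} [AddCommGroup V] [Module ℂ V] (f : ℂ → ℂ) (T S : Module.End ℂ V) :
    Prop :=
  ∃ p : Polynomial ℂ, S = Polynomial.aeval T p ∧
    ∀ μ : ℂ, T.HasEigenvalue μ → ∀ k < Module.finrank ℂ V,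
      iteratedDeriv k (fun z => p.eval z) μ = iteratedDeriv k f μ

open Classical in
/-- `f(T)` for an endomorphism of a finite-dimensional space and `f` holomorphic near the
spectrum of `T`. Such an operator exists by Hermite interpolation, and is unique by
Cayley-Hamilton. -/
def funCalc {V : Type*} [AddCommGroup V] [Module ℂ V] (f : ℂ → ℂ) (T : Module.End ℂ V) :
    Module.End ℂ V :=
  if h : ∃ S, IsFunCalc f T S then h.choose else 0

/-- The domain of the Alekseev-Meinrenken r-matrix: no eigenvalue of `ad x^∨` lies in
`2πi(ℤ \ {0})`. -/
def amDomain (B : LinearMap.BilinForm ℂ L) : Set (Module.Dual ℂ L) :=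
  {x | ∀ n : ℤ, n ≠ 0 →
    ¬ (LieAlgebra.ad ℂ L (sharp B x)).HasEigenvalue (2 * Real.pi * Complex.I * n)}

/-- The Alekseev-Meinrenken dynamical r-matrix `x ↦ (id ⊗ φ(ad x^∨))(Ω)`. -/
def rAM (B : LinearMap.BilinForm ℂ L) (x : Module.Dual ℂ L) : L ⊗[ℂ] L :=
  TensorProduct.map LinearMap.id (funCalc phi (LieAlgebra.ad ℂ L (sharp B x))) (casimir B)

/-- `∑ᵢ δ(eⁱ) ⊗ eᵢ` for a basis `(eᵢ)` of `L` with dual basis `(eⁱ)` of `L*`. For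
`δ = ρ⁻¹ dρ` at `x` this is `(ρ₁⁻¹ d₂ρ₁)(x)`. -/
def derivTensor (δ : Module.Dual ℂ L →ₗ[ℂ] L) : L ⊗[ℂ] L :=
  ∑ i, δ ((Module.finBasis ℂ L).coord i) ⊗ₜ[ℂ] (Module.finBasis ℂ L i)

/-- `∑ᵢⱼ ⟨x, [eᵢ, eⱼ]⟩ δ(eⁱ) ⊗ δ(eʲ)`. For `δ = ρ⁻¹ dρ` at `x` this is
`⟨id ⊗ id ⊗ x, [ρ₁⁻¹ d₃ρ₁, ρ₂⁻¹ d₃ρ₂]⟩`. -/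
def bracketTensor (x : Module.Dual ℂ L) (δ : Module.Dual ℂ L →ₗ[ℂ] L) : L ⊗[ℂ] L :=
  ∑ i, ∑ j, x ⁅Module.finBasis ℂ L i, Module.finBasis ℂ L j⁆ •
    (δ ((Module.finBasis ℂ L).coord i) ⊗ₜ[ℂ] δ ((Module.finBasis ℂ L).coord j))

/-- The coadjoint action `⟨ad*_u x, y⟩ = -⟨x, [u, y]⟩`. -/
def coad (u : L) (x : Module.Dual ℂ L) : Module.Dual ℂ L :=
  -(x ∘ₗ (LieAlgebra.ad ℂ L u))

end Algebra

/-! ### Complex Lie groups -/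

section Group

variable {E : Type*} [NormedAddCommGroup E] [NormedSpace ℂ E] [FiniteDimensional ℂ E]
  {G : Type*} [TopologicalSpace G] [ChartedSpace E G] [Group G]
  {E₁ : Type*} [NormedAddCommGroup E₁] [NormedSpace ℂ E₁] [FiniteDimensional ℂ E₁]
  {G₁ : Type*} [TopologicalSpace G₁] [ChartedSpace E₁ G₁] [Group G₁]

variable (E G) in
/-- The Lie algebra (tangent space at `1`) of a complex Lie group modelled on `E`. -/
abbrev LieAlg : Type _ := GroupLieAlgebra 𝓘(ℂ, E) G

instance instFiniteDimensionalLieAlg : FiniteDimensional ℂ (LieAlg E G) :=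
  inferInstanceAs (FiniteDimensional ℂ E)

variable (E G) in
/-- `LieAlg E G` is the vector space `E`, so its dual is the normed space `StrongDual ℂ E`;
this is the identity map between the two descriptions of `𝔤*`. -/
def dualEquiv : Module.Dual ℂ (LieAlg E G) ≃ₗ[ℂ] StrongDual ℂ E :=
  (LinearMap.toContinuousLinearMap : (E →ₗ[ℂ] ℂ) ≃ₗ[ℂ] (E →L[ℂ] ℂ))

variable (E G) in
/-- A point of `𝔤*` as a linear functional on the Lie algebra. -/
def toDual (x : StrongDual ℂ E) : Module.Dual ℂ (LieAlg E G) := (dualEquiv E G).symm x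

/-- The differential at `1` of a homomorphism of Lie groups. -/
def lieMap (ι : G₁ →* G) : LieAlg E₁ G₁ →L[ℂ] LieAlg E G :=
  mfderiv 𝓘(ℂ, E₁) 𝓘(ℂ, E) (fun y => ι y) (1 : G₁)

/-- The adjoint action: the differential at `1` of `y ↦ g y g⁻¹`. -/
def Ad (g : G) : LieAlg E G →L[ℂ] LieAlg E G :=
  mfderiv 𝓘(ℂ, E) 𝓘(ℂ, E) (fun y => g * y * g⁻¹) (1 : G)

/-- `⊗² Ad_g`. -/
def Ad2 (g : G) : LieAlg E G ⊗[ℂ] LieAlg E G →ₗ[ℂ] LieAlg E G ⊗[ℂ] LieAlg E G :=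
  TensorProduct.map (Ad g).toLinearMap (Ad g).toLinearMap

/-- The map `𝔤₁ ⊗ 𝔤₁ → 𝔤 ⊗ 𝔤` induced by `ι : G₁ → G`. -/
def lieMap2 (ι : G₁ →* G) :
    LieAlg E₁ G₁ ⊗[ℂ] LieAlg E₁ G₁ →ₗ[ℂ] LieAlg E G ⊗[ℂ] LieAlg E G :=
  TensorProduct.map (lieMap ι).toLinearMap (lieMap ι).toLinearMap

/-- The projection `𝔤* → 𝔤₁*`, dual to the inclusion `𝔤₁ → 𝔤`. Under the identifications given
by an invariant form it is the orthogonal projection of `𝔤` onto `𝔤₁`. -/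
def dualProj (ι : G₁ →* G) (x : StrongDual ℂ E) : StrongDual ℂ E₁ :=
  ContinuousLinearMap.comp (M₁ := E₁) (M₂ := E) x (lieMap (E := E) (E₁ := E₁) ι)

/-- The invariant form on `𝔤₁` obtained by restricting the form of `𝔤`. -/
def formRestrict (B : LinearMap.BilinForm ℂ (LieAlg E G)) (ι : G₁ →* G) :
    LinearMap.BilinForm ℂ (LieAlg E₁ G₁) :=
  LinearMap.BilinForm.comp B (lieMap ι).toLinearMap (lieMap ι).toLinearMap

/-- The left logarithmic derivative `ρ⁻¹ dρ` at `x` of a map `ρ : 𝔤* → G`. -/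
def leftLogDeriv (ρ : StrongDual ℂ E → G) (x : StrongDual ℂ E) :
    StrongDual ℂ E →L[ℂ] LieAlg E G :=
  mfderiv 𝓘(ℂ, StrongDual ℂ E) 𝓘(ℂ, E) (fun y => (ρ x)⁻¹ * ρ y) x

variable (ρ : StrongDual ℂ E → G)

/-- `ρ⁻¹ dρ` at `x` as a linear map `𝔤* → 𝔤`. -/
def lieLogDeriv (x : StrongDual ℂ E) : Module.Dual ℂ (LieAlg E G) →ₗ[ℂ] LieAlg E G :=
  (leftLogDeriv ρ x).toLinearMap ∘ₗ (dualEquiv E G).toLinearMap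

variable [LieGroup 𝓘(ℂ, E) ω G] [LieGroup 𝓘(ℂ, E₁) ω G₁]

/-- The gauge transform at `x` of a constant `r ∈ 𝔤 ⊗ 𝔤` by a map `ρ : 𝔤* → G`:
`r^ρ = ρ₁⁻¹ d₂ρ₁ - ρ₂⁻¹ d₁ρ₂ + (⊗² Ad_ρ)⁻¹ r - ⟨id ⊗ id ⊗ x, [ρ₁⁻¹ d₃ρ₁, ρ₂⁻¹ d₃ρ₂]⟩`. -/
def gaugeTransform (r : LieAlg E G ⊗[ℂ] LieAlg E G) (x : StrongDual ℂ E) :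
    LieAlg E G ⊗[ℂ] LieAlg E G :=
  derivTensor (lieLogDeriv ρ x)
    - TensorProduct.comm ℂ (LieAlg E G) (LieAlg E G) (derivTensor (lieLogDeriv ρ x))
    + Ad2 (ρ x)⁻¹ r
    - bracketTensor (toDual E G x) (lieLogDeriv ρ x)

/-- A map `C`, holomorphic on the open set `D ⊆ 𝔤*`, is a relative Ginzburg-Weinstein twist on
`D`: it solves the relative gauge equation, it is `𝔥`-equivariant for the coadjoint action on
`𝔤*` and the conjugation action on `G`, and it is `1` on `𝔤₁* ⊆ 𝔤*`. Here `𝔥` is the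
centralizer of `lam`, `𝔤₁ = [𝔥, 𝔥]`, and `r`, `r₁` are the r-matrices of `𝔤`, `𝔤₁`. -/
structure IsRelativeTwist (B : LinearMap.BilinForm ℂ (LieAlg E G)) (lam : LieAlg E G)
    (ι : G₁ →* G) (r : LieAlg E G ⊗[ℂ] LieAlg E G) (r₁ : LieAlg E₁ G₁ ⊗[ℂ] LieAlg E₁ G₁)
    (D : Set (StrongDual ℂ E)) (C : StrongDual ℂ E → G) : Prop where
  holomorphic : MDifferentiableOn 𝓘(ℂ, StrongDual ℂ E) 𝓘(ℂ, E) C D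
  gauge_eq : ∀ x ∈ D,
    rAM B (toDual E G x)
      - Ad2 (C x)⁻¹ (lieMap2 ι (rAM (formRestrict B ι) (toDual E₁ G₁ (dualProj (G := G) ι x))))
      = gaugeTransform C (r - lieMap2 ι r₁) x
  /-- The derivative of `C(Ad*_h x) = h C(x) h⁻¹` at `h = 1` in the direction `u ∈ 𝔥`,
  left-translated to `1`. -/
  equivariant : ∀ x ∈ D, ∀ u ∈ levi lam,
    lieLogDeriv C x (coad u (toDual E G x)) = Ad (C x)⁻¹ u - u
  eq_one : ∀ x ∈ D, sharp B (toDual E G x) ∈ leviDerived lam → C x = 1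

end Group

end GWTwist

end

open GWTwist

/-! The gauge action is compatible with products. Write `r`, `r₁` for the two standard r-matrices
and `p` for restriction of functionals. For $\rho=\rho_1\cdot C$ one has
$$r^{\rho}=(r-r_1)^C+(\otimes^2\mathrm{Ad}_C)^{-1}\bigl(r_1^{\rho_1}\circ p\bigr)$$
(`gaugeTransform_mul`). Substituting the twist equation turns this into
$$r^\rho-r_{\mathrm{AM},\mathfrak
g}=(\otimes^2\mathrm{Ad}_C)^{-1}\bigl((r_1^{\rho_1}-r_{\mathrm{AM},\mathfrak g_1})\circ p\bigr).$$
Since $\otimes^2\mathrm{Ad}$ and $\mathfrak g_1\otimes\mathfrak g_1\to\mathfrak g\otimes\mathfrak g$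
are injective, one side vanishes exactly when the other does.

The product formula rests on two facts. In the derivative part (`gaugePart_add`, fed by
`lieLogDeriv_mul`), the cross terms of the quadratic expression are computed from the equivariance
of $C$ under $\mathfrak g_1$, and they convert $\mathrm{Ad}_C^{-1}\otimes\mathrm{id}$ into
$\mathrm{Ad}_C^{-1}\otimes\mathrm{Ad}_C^{-1}$ on $\rho_1^{-1}d\rho_1$. In the constant part, $r-r_1$
is a sum over the roots of a nilradical, hence is killed by $\mathfrak h$
(`adTensor_standardR_eq_zero`) and fixed by the connected group $G_1$
(`Ad2_eq_self_of_adTensor_eq_zero`).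

The Lie theory needed, namely that the derivative of $\mathrm{Ad}$ is the bracket and that $d\iota$
preserves brackets, is obtained by calculus in the chart at $1$. -/

noncomputable section

namespace GWTwist

/-! ### The canonical element of $L^*\otimes L$ and its naturality -/

section Coevaluation

variable {L L₁ M N M' N' : Type*} [AddCommGroup L] [Module ℂ L] [FiniteDimensional ℂ L]
  [AddCommGroup L₁] [Module ℂ L₁] [FiniteDimensional ℂ L₁]
  [AddCommGroup M] [Module ℂ M] [AddCommGroup N] [Module ℂ N]
  [AddCommGroup M'] [Module ℂ M'] [AddCommGroup N'] [Module ℂ N']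

/-- The image `∑ᵢ δ(eⁱ) ⊗ μ(eᵢ)` of the canonical element of `L* ⊗ L`. -/
def coev (δ : Module.Dual ℂ L →ₗ[ℂ] M) (μ : L →ₗ[ℂ] N) : M ⊗[ℂ] N :=
  ∑ i, δ ((Module.finBasis ℂ L).coord i) ⊗ₜ[ℂ] μ (Module.finBasis ℂ L i)

lemma coev_add_left (δ δ' : Module.Dual ℂ L →ₗ[ℂ] M) (μ : L →ₗ[ℂ] N) :
    coev (δ + δ') μ = coev δ μ + coev δ' μ := by
  simp [coev, TensorProduct.add_tmul, Finset.sum_add_distrib]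

lemma coev_add_right (δ : Module.Dual ℂ L →ₗ[ℂ] M) (μ μ' : L →ₗ[ℂ] N) :
    coev δ (μ + μ') = coev δ μ + coev δ μ' := by
  simp [coev, TensorProduct.tmul_add, Finset.sum_add_distrib]

lemma coev_sub_right (δ : Module.Dual ℂ L →ₗ[ℂ] M) (μ μ' : L →ₗ[ℂ] N) :
    coev δ (μ - μ') = coev δ μ - coev δ μ' := by
  simp [coev, TensorProduct.tmul_sub, Finset.sum_sub_distrib]

lemma coev_comp (f : M →ₗ[ℂ] M') (g : N →ₗ[ℂ] N') (δ : Module.Dual ℂ L →ₗ[ℂ] M)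
    (μ : L →ₗ[ℂ] N) : coev (f ∘ₗ δ) (g ∘ₗ μ) = TensorProduct.map f g (coev δ μ) := by
  simp [coev, map_sum]

/-- Both sides expand to the same double sum over the matrix of `ι`. This is how the projection
$p=\iota^*$ is traded for the inclusion `ι` in the other tensor factor. -/
lemma coev_dualMap (ι : L₁ →ₗ[ℂ] L) (δ : Module.Dual ℂ L₁ →ₗ[ℂ] M) (μ : L →ₗ[ℂ] N) :
    coev (δ ∘ₗ ι.dualMap) μ = coev δ (μ ∘ₗ ι) := by
  have h1 : ∀ i, ι.dualMap ((Module.finBasis ℂ L).coord i) =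
      ∑ a, (Module.finBasis ℂ L).coord i (ι (Module.finBasis ℂ L₁ a)) •
        (Module.finBasis ℂ L₁).coord a := by
    intro i
    refine (Module.finBasis ℂ L₁).ext fun a => ?_
    simp [Finsupp.single_apply]
  have h2 : ∀ a, ι (Module.finBasis ℂ L₁ a) =
      ∑ i, (Module.finBasis ℂ L).coord i (ι (Module.finBasis ℂ L₁ a)) •
        Module.finBasis ℂ L i := fun a => by
    simp [Module.Basis.sum_repr]
  have h3 : ∀ a, μ (ι (Module.finBasis ℂ L₁ a)) =
      ∑ i, (Module.finBasis ℂ L).coord i (ι (Module.finBasis ℂ L₁ a)) •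
        μ (Module.finBasis ℂ L i) := fun a => by
    conv_lhs => rw [h2 a]
    simp only [map_sum, map_smul]
  simp only [coev, LinearMap.comp_apply, h1, h3, map_sum, map_smul, TensorProduct.sum_tmul,
    TensorProduct.tmul_sum, TensorProduct.smul_tmul', TensorProduct.tmul_smul]
  exact Finset.sum_comm

end Coevaluation

/-! ### The derivative part of the gauge transform on a product -/

section Gauge

variable {L L₁ M N : Type*} [LieRing L] [LieAlgebra ℂ L] [FiniteDimensional ℂ L]
  [LieRing L₁] [LieAlgebra ℂ L₁] [FiniteDimensional ℂ L₁]
  [AddCommGroup M] [Module ℂ M] [AddCommGroup N] [Module ℂ N]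

/-- The map `u ↦ ⟨x, [u, ·]⟩`. -/
def kirillov (x : Module.Dual ℂ L) : L →ₗ[ℂ] Module.Dual ℂ L where
  toFun u := x ∘ₗ LieAlgebra.ad ℂ L u
  map_add' u v := by simp [LinearMap.comp_add]
  map_smul' c u := by simp [LinearMap.comp_smul]

omit [FiniteDimensional ℂ L] in
lemma kirillov_apply (x : Module.Dual ℂ L) (u v : L) : kirillov x u v = x ⁅u, v⁆ := rfl

omit [FiniteDimensional ℂ L] in
lemma kirillov_eq_neg_coad (x : Module.Dual ℂ L) (u : L) : kirillov x u = -coad u x := by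
  simp [coad, kirillov]

/-- Polarises `bracketTensor`, the case `δ = δ'`, so that its value on a sum of two logarithmic
derivatives can be expanded. -/
lemma coev_kirillov (x : Module.Dual ℂ L) (δ : Module.Dual ℂ L →ₗ[ℂ] M)
    (δ' : Module.Dual ℂ L →ₗ[ℂ] N) :
    coev δ (δ' ∘ₗ kirillov x) = ∑ i, ∑ j, x ⁅Module.finBasis ℂ L i, Module.finBasis ℂ L j⁆ •
      (δ ((Module.finBasis ℂ L).coord i) ⊗ₜ[ℂ] δ' ((Module.finBasis ℂ L).coord j)) := by
  have h : ∀ i, kirillov x (Module.finBasis ℂ L i) =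
      ∑ j, x ⁅Module.finBasis ℂ L i, Module.finBasis ℂ L j⁆ •
        (Module.finBasis ℂ L).coord j := by
    intro i
    refine (Module.finBasis ℂ L).ext fun a => ?_
    simp [Finsupp.single_apply, kirillov_apply]
  simp only [coev, LinearMap.comp_apply, h, map_sum, map_smul, TensorProduct.tmul_sum,
    TensorProduct.tmul_smul]

/-- Skew-symmetry of $\langle x,[\cdot,\cdot]\rangle$; it yields the second cross term from the
first. -/
lemma coev_kirillov_comm (x : Module.Dual ℂ L) (δ : Module.Dual ℂ L →ₗ[ℂ] M)
    (δ' : Module.Dual ℂ L →ₗ[ℂ] N) :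
    coev δ' (δ ∘ₗ kirillov x) = -TensorProduct.comm ℂ M N (coev δ (δ' ∘ₗ kirillov x)) := by
  simp only [coev_kirillov, map_sum, map_smul, TensorProduct.comm_tmul, ← Finset.sum_neg_distrib]
  rw [Finset.sum_comm]
  refine Finset.sum_congr rfl fun i _ => Finset.sum_congr rfl fun j _ => ?_
  rw [← lie_skew, map_neg, neg_smul]

lemma derivTensor_eq_coev (δ : Module.Dual ℂ L →ₗ[ℂ] L) :
    derivTensor δ = coev δ LinearMap.id := rfl

lemma derivTensor_add (δ δ' : Module.Dual ℂ L →ₗ[ℂ] L) :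
    derivTensor (δ + δ') = derivTensor δ + derivTensor δ' := by
  simp only [derivTensor_eq_coev, coev_add_left]

lemma bracketTensor_eq_coev (x : Module.Dual ℂ L) (δ : Module.Dual ℂ L →ₗ[ℂ] L) :
    bracketTensor x δ = coev δ (δ ∘ₗ kirillov x) := (coev_kirillov x δ δ).symm

/-- The part of the gauge transform that does not involve the constant `r`. -/
def gaugePart (x : Module.Dual ℂ L) (δ : Module.Dual ℂ L →ₗ[ℂ] L) : L ⊗[ℂ] L :=
  derivTensor δ - TensorProduct.comm ℂ L L (derivTensor δ) - bracketTensor x δ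

/-- The gauge part of a product `ι(ρ₁) C`, where `A = Ad C⁻¹` and `C` is equivariant. -/
lemma gaugePart_add (ι : L₁ →ₗ[ℂ] L) (hι : ∀ a b, ι ⁅a, b⁆ = ⁅ι a, ι b⁆) (A : L →ₗ[ℂ] L)
    (x : Module.Dual ℂ L) (δ₁ : Module.Dual ℂ L₁ →ₗ[ℂ] L₁) (δ : Module.Dual ℂ L →ₗ[ℂ] L)
    (hδ : ∀ a, δ (coad (ι a) x) = A (ι a) - ι a) :
    gaugePart x ((A ∘ₗ ι) ∘ₗ δ₁ ∘ₗ ι.dualMap + δ) =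
      gaugePart x δ +
        TensorProduct.map (A ∘ₗ ι) (A ∘ₗ ι) (gaugePart (ι.dualMap x) δ₁) := by
  obtain ⟨f, hf⟩ : ∃ f, f = A ∘ₗ ι := ⟨_, rfl⟩
  rw [← hf]
  -- Equivariance, with its sign reversed because `kirillov` is minus the coadjoint action.
  have h1 : δ ∘ₗ kirillov x ∘ₗ ι = ι - f := by
    ext a
    simp [kirillov_eq_neg_coad, hδ, hf]
  have h2 : ι.dualMap ∘ₗ kirillov x ∘ₗ ι = kirillov (ι.dualMap x) := by
    ext a b
    simp [kirillov_apply, hι]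
  have hD : derivTensor (f ∘ₗ δ₁ ∘ₗ ι.dualMap) = TensorProduct.map f ι (derivTensor δ₁) := by
    rw [derivTensor_eq_coev, derivTensor_eq_coev, ← LinearMap.comp_assoc, coev_dualMap,
      ← coev_comp]
    rfl
  -- The decisive cross term: its `f ⊗ ι` summand cancels the derivative term `hD`, leaving `f ⊗ f`
  -- applied to `derivTensor δ₁`.
  have hK1 : coev (f ∘ₗ δ₁ ∘ₗ ι.dualMap) (δ ∘ₗ kirillov x) =
      TensorProduct.map f ι (derivTensor δ₁) - TensorProduct.map f f (derivTensor δ₁) := by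
    rw [← LinearMap.comp_assoc, coev_dualMap, LinearMap.comp_assoc ι (kirillov x) δ, h1, coev_sub_right,
      derivTensor_eq_coev, ← coev_comp, ← coev_comp]
    rfl
  have hK2 := coev_kirillov_comm x (f ∘ₗ δ₁ ∘ₗ ι.dualMap) δ
  have hK3 : coev (f ∘ₗ δ₁ ∘ₗ ι.dualMap) ((f ∘ₗ δ₁ ∘ₗ ι.dualMap) ∘ₗ kirillov x) =
      TensorProduct.map f f (bracketTensor (ι.dualMap x) δ₁) := by
    rw [bracketTensor_eq_coev, ← coev_comp, ← h2]
    conv_lhs => rw [← LinearMap.comp_assoc, coev_dualMap]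
    rfl
  have hc : ∀ z : L₁ ⊗[ℂ] L₁, TensorProduct.comm ℂ L L (TensorProduct.map f f z) =
      TensorProduct.map f f (TensorProduct.comm ℂ L₁ L₁ z) := fun z =>
    (TensorProduct.map_comm f f z).symm
  have hadd : derivTensor (f ∘ₗ δ₁ ∘ₗ ι.dualMap + δ) =
      derivTensor (f ∘ₗ δ₁ ∘ₗ ι.dualMap) + derivTensor δ := derivTensor_add _ _
  simp only [gaugePart]
  rw [hadd, bracketTensor_eq_coev x (_ + _), coev_add_left, LinearMap.add_comp, coev_add_right,
    coev_add_right, hK2, hK1, hK3, hD, ← bracketTensor_eq_coev]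
  simp only [map_sub, map_add, hc]
  abel

end Gauge

/-! ### Orthogonality of generalized eigenspaces; contraction of tensors -/

section Orthogonality

/-- Generalized eigenspaces of a skew endomorphism are orthogonal unless the eigenvalues are
opposite. -/
lemma apply_eq_zero_of_mem_maxGenEigenspace {V : Type*} [AddCommGroup V] [Module ℂ V]
    {B : LinearMap.BilinForm ℂ V} {T : Module.End ℂ V} (hT : ∀ x y, B (T x) y = -B x (T y))
    {a b : ℂ} (hab : a + b ≠ 0) {x y : V} (hx : x ∈ T.maxGenEigenspace a)
    (hy : y ∈ T.maxGenEigenspace b) : B x y = 0 := by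
  -- Induction on the total nilpotency order, through the identity
  -- $B((T-a)x,y)+B(x,(T-b)y)=-(a+b)B(x,y)$.
  have key : ∀ n k m : ℕ, k + m ≤ n → ∀ x y : V, ((T - a • 1) ^ k) x = 0 →
      ((T - b • 1) ^ m) y = 0 → B x y = 0 := by
    intro n
    induction n with
    | zero =>
      intro k m hkm x y hx _
      obtain rfl : k = 0 := by omega
      simp_all
    | succ n ih =>
      intro k m hkm x y hx hy
      rcases k with _ | k
      · simp_all
      rcases m with _ | m
      · simp_all
      have h1 : B ((T - a • 1) x) y = 0 :=
        ih k (m + 1) (by omega) _ _ (by rwa [pow_succ] at hx) hy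
      have h2 : B x ((T - b • 1) y) = 0 :=
        ih (k + 1) m (by omega) _ _ hx (by rwa [pow_succ] at hy)
      have h3 : (a + b) * B x y = 0 := by
        simp only [LinearMap.sub_apply, LinearMap.smul_apply, Module.End.one_apply, map_sub,
          map_smul, smul_eq_mul, hT] at h1 h2
        linear_combination -h1 - h2
      exact (mul_eq_zero.mp h3).resolve_left hab
  obtain ⟨k, hk⟩ := Module.End.mem_maxGenEigenspace T a x |>.mp hx
  obtain ⟨m, hm⟩ := Module.End.mem_maxGenEigenspace T b y |>.mp hy
  exact key _ k m le_rfl x y hk hm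

/-- A tensor is determined by its contractions with a nondegenerate form. -/
lemma tensor_eq_zero_of_contractions {V W : Type*} [AddCommGroup V] [Module ℂ V]
    [FiniteDimensional ℂ V] [AddCommGroup W] [Module ℂ W]
    {B : LinearMap.BilinForm ℂ V} (hB : B.Nondegenerate) (z : W ⊗[ℂ] V)
    (h : ∀ x, TensorProduct.rid ℂ W (TensorProduct.map LinearMap.id (LinearMap.flip B x) z) = 0) :
    z = 0 := by
  classical
  set b := Module.finBasis ℂ V
  obtain ⟨c, rfl⟩ := TensorProduct.eq_repr_basis_right (B.dualBasis hB b) z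
  have hc : ∀ j, c j = 0 := by
    intro j
    have := h (b j)
    simpa [Finsupp.sum, LinearMap.BilinForm.apply_dualBasis_left] using this
  have : c = 0 := Finsupp.ext hc
  simp [this]

end Orthogonality

/-! ### Invariance of the nilradical part of the r-matrix under the Levi subalgebra -/

section Roots

variable {L : Type*} [LieRing L] [LieAlgebra ℂ L]

/-- The derivation action of `u` on `L ⊗ L`. -/
def adTensor (u : L) : L ⊗[ℂ] L →ₗ[ℂ] L ⊗[ℂ] L :=
  TensorProduct.map (LieAlgebra.ad ℂ L u) LinearMap.id +
    TensorProduct.map LinearMap.id (LieAlgebra.ad ℂ L u)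

@[simp] lemma adTensor_tmul (u a b : L) :
    adTensor u (a ⊗ₜ[ℂ] b) = ⁅u, a⁆ ⊗ₜ[ℂ] b + a ⊗ₜ[ℂ] ⁅u, b⁆ := by
  simp [adTensor]

lemma adTensor_comm (u : L) (z : L ⊗[ℂ] L) :
    adTensor u (TensorProduct.comm ℂ L L z) = TensorProduct.comm ℂ L L (adTensor u z) := by
  induction z with
  | zero => simp
  | tmul a b => simp [add_comm]
  | add a b ha hb => simp [ha, hb]

variable {B : LinearMap.BilinForm ℂ L} (hB : IsInvariantForm B)
include hB

lemma IsInvariantForm.lie_left (u x y : L) : B ⁅u, x⁆ y = -B x ⁅u, y⁆ := by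
  rw [← lie_skew, map_neg, LinearMap.neg_apply, hB.invariant]

lemma IsInvariantForm.ad_left (u x y : L) :
    B (LieAlgebra.ad ℂ L u x) y = -B x (LieAlgebra.ad ℂ L u y) := hB.lie_left u x y

variable [FiniteDimensional ℂ L] {t : LieSubalgebra ℂ L} [t.IsCartanSubalgebra]

omit hB [FiniteDimensional ℂ L] in
lemma mem_maxGenEigenspace_of_mem_rootSpace {χ : t → ℂ} {x : L}
    (hx : x ∈ LieAlgebra.rootSpace t χ) (h : t) :
    x ∈ (LieAlgebra.ad ℂ L (h : L)).maxGenEigenspace (χ h) := by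
  have := LieModule.genWeightSpace_le_genWeightSpaceOf L h χ hx
  exact this

/-- A vector orthogonal to all root spaces (including the zero root space) vanishes. -/
lemma IsInvariantForm.eq_zero_of_rootSpaces {y : L}
    (h : ∀ χ : LieModule.Weight ℂ t L, ∀ z ∈ LieAlgebra.rootSpace t χ, B z y = 0) : y = 0 := by
  refine hB.nondegenerate.2 y fun z => ?_
  have hz : z ∈ (⨆ χ : LieModule.Weight ℂ t L, LieModule.genWeightSpace L χ : LieSubmodule ℂ t L) := by
    rw [LieModule.iSup_genWeightSpace_eq_top']
    trivial
  refine LieSubmodule.iSup_induction' _ (motive := fun z _ => B z y = 0) ?_ ?_ ?_ hz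
  · intro χ z hz
    exact h χ z hz
  · simp
  · intro a b _ _ ha hb
    simp [ha, hb]

variable {e : Module.Dual ℂ t → L} (he : IsRootVectors B t e)
include he

omit hB [FiniteDimensional ℂ L] in
lemma IsRootVectors.mem_rootSpace {α : Module.Dual ℂ t} (hα : α ∈ roots t) :
    e α ∈ LieAlgebra.rootSpace t (⇑α) := by
  have := Submodule.mem_span_singleton_self (R := ℂ) (e α)
  rw [he.span_eq α hα] at this
  exact this

omit hB [FiniteDimensional ℂ L] in
lemma IsRootVectors.mem_maxGenEigenspace {α : Module.Dual ℂ t} (hα : α ∈ roots t) (h : t) :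
    e α ∈ (LieAlgebra.ad ℂ L (h : L)).maxGenEigenspace (α h) :=
  mem_maxGenEigenspace_of_mem_rootSpace (he.mem_rootSpace hα) h

/-- Otherwise `e α` would be orthogonal to every weight space, hence zero, contradicting the
normalisation. -/
lemma IsRootVectors.neg_mem_roots {α : Module.Dual ℂ t} (hα : α ∈ roots t) : -α ∈ roots t := by
  by_contra hn
  have hbot : LieAlgebra.rootSpace t (⇑(-α)) = ⊥ := by
    by_contra h
    exact hn ⟨neg_ne_zero.mpr hα.1, h⟩
  have h0 : e α = 0 := by
    refine hB.eq_zero_of_rootSpaces (t := t) fun χ z hz => ?_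
    by_cases hχ : (χ : t → ℂ) = ⇑(-α)
    · rw [hχ, hbot] at hz
      obtain rfl : z = 0 := by simpa using hz
      simp
    · obtain ⟨h, hh⟩ := Function.ne_iff.mp hχ
      refine apply_eq_zero_of_mem_maxGenEigenspace (hB.ad_left (h : L)) (b := α h) (a := χ h) ?_
        (mem_maxGenEigenspace_of_mem_rootSpace hz h) (he.mem_maxGenEigenspace hα h)
      intro h'
      exact hh (by simpa using eq_neg_of_add_eq_zero_left h')
  have := he.norm_eq α hα
  simp [h0] at this

omit [FiniteDimensional ℂ L] in
lemma IsRootVectors.apply_eq_zero {α β : Module.Dual ℂ t} (hα : α ∈ roots t) (hβ : β ∈ roots t)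
    (hαβ : β ≠ -α) : B (e α) (e β) = 0 := by
  obtain ⟨h, hh⟩ : ∃ h, β h ≠ (-α) h := by
    by_contra! hc
    exact hαβ (LinearMap.ext hc)
  refine apply_eq_zero_of_mem_maxGenEigenspace (hB.ad_left (h : L)) ?_
    (he.mem_maxGenEigenspace hα h) (he.mem_maxGenEigenspace hβ h)
  intro h'
  exact hh (by simpa using eq_neg_of_add_eq_zero_right h')

omit he hB [FiniteDimensional ℂ L] in
open Classical in
/-- The positive roots not vanishing on `lam`: the roots of the nilradical of the parabolic
subalgebra attached to `P` and `lam`. -/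
def nilradPos (P : Finset (Module.Dual ℂ t)) (lam : t) : Finset (Module.Dual ℂ t) :=
  P.filter fun α => α lam ≠ 0

omit he hB [FiniteDimensional ℂ L] [t.IsCartanSubalgebra] in
lemma mem_nilradPos {P : Finset (Module.Dual ℂ t)} {lam : t} {α : Module.Dual ℂ t} :
    α ∈ nilradPos P lam ↔ α ∈ P ∧ α lam ≠ 0 := by
  simp [nilradPos]

omit he hB [FiniteDimensional ℂ L] in
variable (B e) in
/-- The projection to the span of the `e α`, `α ∈ N`, along the orthogonal complement of the span
of the `e (-α)`. -/
def rootProj (N : Finset (Module.Dual ℂ t)) : Module.End ℂ L :=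
  ∑ α ∈ N, (B (e (-α))).smulRight (e α)

omit he hB [FiniteDimensional ℂ L] [t.IsCartanSubalgebra] in
lemma rootProj_apply (N : Finset (Module.Dual ℂ t)) (x : L) :
    rootProj B e N x = ∑ α ∈ N, B (e (-α)) x • e α := by
  simp [rootProj]

variable {P : Finset (Module.Dual ℂ t)} (hP : IsPositiveSystem t P) {lam : t} {θ : ℂ}
  (hθ : ∀ α ∈ P, α lam ≠ 0 → 0 < (α lam / θ).im)
include hP hθ

/-- For `α` in the nilradical, `e (-α)` pairs only with the eigenvalue `α lam` of `ad lam`, which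
lies in the open half-plane. -/
lemma rootProj_eq_zero {c : ℂ} (hc : ¬ 0 < (c / θ).im) {x : L}
    (hx : x ∈ (LieAlgebra.ad ℂ L (lam : L)).maxGenEigenspace c) :
    rootProj B e (nilradPos P lam) x = 0 := by
  rw [rootProj_apply]
  refine Finset.sum_eq_zero fun α hα => ?_
  obtain ⟨hαP, hα0⟩ := mem_nilradPos.mp hα
  have hαr := hP.subset_roots α hαP
  rw [apply_eq_zero_of_mem_maxGenEigenspace (hB.ad_left (lam : L)) (a := (-α) lam) (b := c) ?_
    (he.mem_maxGenEigenspace (he.neg_mem_roots hB hαr) lam) hx, zero_smul]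
  intro h
  have : c = α lam := by
    rw [LinearMap.neg_apply] at h
    linear_combination h
  exact hc (this ▸ hθ α hαP hα0)

/-- The difference of the two sides has eigenvalue `c`, so only weight spaces of eigenvalue `-c` can
detect it. Those belong to negatives of nilradical roots, where both sides have the same pairing. -/
lemma rootProj_eq_self {c : ℂ} (hc : 0 < (c / θ).im) {x : L}
    (hx : x ∈ (LieAlgebra.ad ℂ L (lam : L)).maxGenEigenspace c) :
    rootProj B e (nilradPos P lam) x = x := by
  have hc0 : c ≠ 0 := by
    rintro rfl
    simp at hc
  have hmem : rootProj B e (nilradPos P lam) x ∈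
      (LieAlgebra.ad ℂ L (lam : L)).maxGenEigenspace c := by
    rw [rootProj_apply]
    refine Submodule.sum_mem _ fun α hα => ?_
    have hαr := hP.subset_roots α (mem_nilradPos.mp hα).1
    by_cases h : α lam = c
    · exact Submodule.smul_mem _ _ (h ▸ he.mem_maxGenEigenspace hαr lam)
    · rw [apply_eq_zero_of_mem_maxGenEigenspace (hB.ad_left (lam : L)) (a := (-α) lam) (b := c) ?_
        (he.mem_maxGenEigenspace (he.neg_mem_roots hB hαr) lam) hx, zero_smul]
      · exact Submodule.zero_mem _
      · intro h'
        rw [LinearMap.neg_apply] at h'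
        exact h (by linear_combination -h')
  symm
  rw [← sub_eq_zero]
  refine hB.eq_zero_of_rootSpaces (t := t) fun χ z hz => ?_
  by_cases hχ : χ lam + c = 0
  · have hχl : χ lam = -c := eq_neg_of_add_eq_zero_left hχ
    set β : Module.Dual ℂ t := LieModule.Weight.toLinear ℂ t L χ with hβ
    have hβχ : (⇑β : t → ℂ) = χ := rfl
    have hβl : β lam = -c := hχl
    have hβr : β ∈ roots t := by
      refine ⟨fun h => hc0 ?_, ?_⟩
      · rw [h] at hβl
        simpa using hβl.symm
      · rw [hβχ]
        exact χ.genWeightSpace_ne_bot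
    -- If `β` were positive, the half-plane condition would apply to `-c` as well as to `c`.
    have hβn : -β ∈ nilradPos P lam := by
      refine mem_nilradPos.mpr ⟨(hP.pos_or_neg β hβr).resolve_left fun h => ?_, ?_⟩
      · have := hθ β h (by rw [hβl]; exact neg_ne_zero.mpr hc0)
        rw [hβl, neg_div, Complex.neg_im] at this
        linarith
      · simpa [hβl] using hc0
    have hz' : z ∈ Submodule.span ℂ {e β} := by
      rw [he.span_eq β hβr]
      exact hz
    obtain ⟨k, rfl⟩ := Submodule.mem_span_singleton.mp hz'
    -- Only the summand `α = -β` pairs with `e β`, and that pairing is `1`.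
    have hsum : B (e β) (rootProj B e (nilradPos P lam) x) = B (e β) x := by
      rw [rootProj_apply, map_sum, Finset.sum_eq_single (-β)]
      · rw [map_smul, he.norm_eq β hβr, neg_neg, smul_eq_mul, mul_one]
      · intro α hα hne
        rw [map_smul, he.apply_eq_zero hB hβr (hP.subset_roots α (mem_nilradPos.mp hα).1) hne,
          smul_zero]
      · exact fun h => absurd hβn h
    rw [map_smul, LinearMap.smul_apply, map_sub, hsum, sub_self, smul_zero]
  · exact apply_eq_zero_of_mem_maxGenEigenspace (hB.ad_left (lam : L)) hχ
      (mem_maxGenEigenspace_of_mem_rootSpace hz lam) (Submodule.sub_mem _ hx hmem)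

/-- On each generalized eigenspace of `ad lam` the projection is `0` or the identity, according to
the eigenvalue alone, and `ad u` preserves these eigenspaces since `u` centralizes `lam`. -/
lemma rootProj_lie {u : L} (hu : u ∈ levi (lam : L)) (x : L) :
    rootProj B e (nilradPos P lam) ⁅u, x⁆ = ⁅u, rootProj B e (nilradPos P lam) x⁆ := by
  set A := LieAlgebra.ad ℂ L (lam : L) with hA
  have hcomm : Commute A (LieAlgebra.ad ℂ L u) := by
    have h0 : ⁅(lam : L), u⁆ = 0 := hu
    refine LinearMap.ext fun y => ?_
    change ⁅(lam : L), ⁅u, y⁆⁆ = ⁅u, ⁅(lam : L), y⁆⁆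
    rw [leibniz_lie, h0, zero_lie, zero_add]
  have hx : x ∈ ⨆ c, A.maxGenEigenspace c := by
    rw [Module.End.iSup_maxGenEigenspace_eq_top]
    trivial
  induction hx using Submodule.iSup_induction' with
  | mem c x hx =>
    have hx' : ⁅u, x⁆ ∈ A.maxGenEigenspace c :=
      Module.End.mapsTo_maxGenEigenspace_of_comm hcomm c hx
    by_cases hc : 0 < (c / θ).im
    · rw [rootProj_eq_self hB he hP hθ hc hx, rootProj_eq_self hB he hP hθ hc hx']
    · rw [rootProj_eq_zero hB he hP hθ hc hx, rootProj_eq_zero hB he hP hθ hc hx', lie_zero]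
  | zero => simp
  | add x y _ _ hx hy => simp [hx, hy]

/-- Contracting the second factor with the form turns the tensor into `rootProj`, and turns
invariance into commutation with `ad u`. -/
lemma adTensor_sum_eq_zero {u : L} (hu : u ∈ levi (lam : L)) :
    adTensor u (∑ α ∈ nilradPos P lam, e α ⊗ₜ[ℂ] e (-α)) = 0 := by
  refine tensor_eq_zero_of_contractions hB.nondegenerate _ fun x => ?_
  have h := rootProj_lie hB he hP hθ hu x
  simp only [rootProj_apply, lie_sum, lie_smul] at h
  simp only [map_sum, adTensor_tmul, map_add, TensorProduct.map_tmul, LinearMap.id_apply,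
    LinearMap.flip_apply, TensorProduct.rid_tmul, hB.lie_left, Finset.sum_add_distrib, neg_smul,
    Finset.sum_neg_distrib, h, add_neg_cancel]

/-- The nilradical part of the standard r-matrix is invariant under the Levi subalgebra. -/
lemma adTensor_standardR_eq_zero {u : L} (hu : u ∈ levi (lam : L)) :
    adTensor u (standardR (nilradPos P lam) e) = 0 := by
  have h : standardR (nilradPos P lam) e = (1 / 2 : ℂ) •
      (∑ α ∈ nilradPos P lam, e α ⊗ₜ[ℂ] e (-α) -
        TensorProduct.comm ℂ L L (∑ α ∈ nilradPos P lam, e α ⊗ₜ[ℂ] e (-α))) := by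
    simp [standardR, wedge, Finset.smul_sum, Finset.sum_sub_distrib, smul_sub]
  rw [h, map_smul, map_sub, adTensor_comm, adTensor_sum_eq_zero hB he hP hθ hu]
  simp

omit [FiniteDimensional ℂ L] hB he hP hθ [t.IsCartanSubalgebra] in
lemma standardR_eq_add (P : Finset (Module.Dual ℂ t))
    (lam : t) (e : Module.Dual ℂ t → L) :
    standardR P e = standardR (nilradPos P lam) e + standardR (leviPos P lam) e := by
  classical
  rw [add_comm]
  exact (Finset.sum_filter_add_sum_filter_not P (fun α => α lam = 0) _).symm

end Roots

/-! ### Second-order calculus of a local multiplication -/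

section Calculus

open ContinuousLinearMap

variable {E : Type*} [NormedAddCommGroup E] [NormedSpace ℂ E]

/-- The mixed second derivative, antisymmetrized, of a local multiplication `m` on `E`. -/
def localBracket (m : E × E → E) (o : E) : E →L[ℂ] E →L[ℂ] E :=
  ((compL ℂ E (E × E) E).flip (inr ℂ E E)) ∘L fderiv ℂ (fderiv ℂ m) (o, o) ∘L inl ℂ E E -
    ((compL ℂ E (E × E) E).flip (inl ℂ E E)) ∘L fderiv ℂ (fderiv ℂ m) (o, o) ∘L inr ℂ E E

lemma hasFDerivAt_fderiv {m : E × E → E} {o : E} (hm : ContDiffAt ℂ ω m (o, o)) :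
    HasFDerivAt (fderiv ℂ m) (fderiv ℂ (fderiv ℂ m) (o, o)) (o, o) :=
  ((hm.fderiv_right (m := 1) (by exact le_top)).differentiableAt (by simp)).hasFDerivAt

/-- When `o` is the unit, the partial derivative in the second slot is the left-invariant frame at
`x`; the one in the first slot, treated next, is the right-invariant frame. -/
lemma hasFDerivAt_partial_snd {m : E × E → E} {o : E} (hm : ContDiffAt ℂ ω m (o, o)) :
    HasFDerivAt (fun x => (fderiv ℂ m (x, o)).comp (inr ℂ E E))
      (((compL ℂ E (E × E) E).flip (inr ℂ E E)) ∘L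
        fderiv ℂ (fderiv ℂ m) (o, o) ∘L inl ℂ E E) o := by
  have h : HasFDerivAt (fun x : E => (x, o)) (inl ℂ E E) o := hasFDerivAt_prodMk_left o o
  exact ((compL ℂ E (E × E) E).flip (inr ℂ E E)).hasFDerivAt.comp o
    (HasFDerivAt.comp (f := fun x : E => (x, o)) o (hasFDerivAt_fderiv hm) h)

lemma hasFDerivAt_partial_fst {m : E × E → E} {o : E} (hm : ContDiffAt ℂ ω m (o, o)) :
    HasFDerivAt (fun x => (fderiv ℂ m (o, x)).comp (inl ℂ E E))
      (((compL ℂ E (E × E) E).flip (inl ℂ E E)) ∘L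
        fderiv ℂ (fderiv ℂ m) (o, o) ∘L inr ℂ E E) o := by
  have h : HasFDerivAt (fun x : E => (o, x)) (inr ℂ E E) o := hasFDerivAt_prodMk_right o o
  exact ((compL ℂ E (E × E) E).flip (inl ℂ E E)).hasFDerivAt.comp o
    (HasFDerivAt.comp (f := fun x : E => (o, x)) o (hasFDerivAt_fderiv hm) h)

/-- If `A` intertwines the two partial derivatives of a local multiplication, then the derivative
of `A` at the unit is the bracket. -/
lemma hasFDerivAt_of_partial_eq [CompleteSpace E] {m : E × E → E} {o : E}
    (hm : ContDiffAt ℂ ω m (o, o)) {A : E → E →L[ℂ] E}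
    (h1 : (fderiv ℂ m (o, o)).comp (inl ℂ E E) = .id ℂ E) (hA1 : A o = .id ℂ E)
    (hA : ∀ᶠ x in nhds o, (fderiv ℂ m (x, o)).comp (inr ℂ E E) =
      ((fderiv ℂ m (o, x)).comp (inl ℂ E E)).comp (A x)) :
    HasFDerivAt A (localBracket m o) o := by
  have hM := hasFDerivAt_partial_fst hm
  have hN := hasFDerivAt_partial_snd hm
  have hinv : ContDiffAt ℂ 1 (inverse : (E →L[ℂ] E) → E →L[ℂ] E)
      ((fderiv ℂ m (o, o)).comp (inl ℂ E E)) := by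
    rw [h1]
    exact contDiffAt_map_inverse (ContinuousLinearEquiv.refl ℂ E)
  have hinvM : DifferentiableAt ℂ
      (fun x => ((fderiv ℂ m (o, x)).comp (inl ℂ E E)).inverse) o :=
    DifferentiableAt.comp (f := fun x => (fderiv ℂ m (o, x)).comp (inl ℂ E E)) o
      (hinv.differentiableAt (by simp)) hM.differentiableAt
  have hunit : ∀ᶠ x in nhds o, ((fderiv ℂ m (o, x)).comp (inl ℂ E E)).IsInvertible := by
    have : {f : E →L[ℂ] E | f.IsInvertible} ∈ nhds ((fderiv ℂ m (o, o)).comp (inl ℂ E E)) := by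
      rw [h1]
      exact ContinuousLinearEquiv.nhds (ContinuousLinearEquiv.refl ℂ E)
    exact hM.continuousAt this
  -- Solving for `A` shows that it is differentiable; its derivative then follows from the product
  -- rule, both factors being the identity at `o`.
  have hAeq : A =ᶠ[nhds o] fun x => ((fderiv ℂ m (o, x)).comp (inl ℂ E E)).inverse.comp
      ((fderiv ℂ m (x, o)).comp (inr ℂ E E)) := by
    filter_upwards [hA, hunit] with x hx hx'
    rw [hx, ← ContinuousLinearMap.comp_assoc, hx'.inverse_comp_self, ContinuousLinearMap.id_comp]
  have hAd : DifferentiableAt ℂ A o :=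
    hAeq.differentiableAt_iff.mpr (hinvM.clm_comp hN.differentiableAt)
  have hprod := hM.clm_comp hAd.hasFDerivAt
  have huniq := (hprod.congr_of_eventuallyEq hA).unique hN
  have : fderiv ℂ A o = localBracket m o := by
    rw [localBracket, ← huniq, h1, hA1]
    ext u v
    simp
  exact this ▸ hAd.hasFDerivAt

/-- Symmetry of the second derivative rewrites the bracket through the left-invariant frame alone,
the form taken by a bracket of left-invariant fields. -/
lemma localBracket_apply {m : E × E → E} {o : E} (hm : ContDiffAt ℂ ω m (o, o)) (u v : E) :
    localBracket m o u v =
      fderiv ℂ (fun x => (fderiv ℂ m (x, o)).comp (inr ℂ E E)) o u v -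
        fderiv ℂ (fun x => (fderiv ℂ m (x, o)).comp (inr ℂ E E)) o v u := by
  rw [(hasFDerivAt_partial_snd hm).fderiv]
  have := (hm.isSymmSndFDerivAt_of_omega).eq (0, u) (v, 0)
  simp [localBracket, this]

end Calculus

/-! ### Group multiplication in the chart at the identity -/

section Chart

variable {E : Type*} [NormedAddCommGroup E] [NormedSpace ℂ E]
  {G : Type*} [TopologicalSpace G] [ChartedSpace E G] [Group G]

local notation "φ" => extChartAt 𝓘(ℂ, E) (1 : G)

variable (E G) in
/-- Multiplication of `G` in the preferred chart at `1`. -/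
def chartMul (p : E × E) : E := φ ((φ).symm p.1 * (φ).symm p.2)

lemma chart_symm_one : (φ).symm (φ 1) = (1 : G) := extChartAt_to_inv (1 : G)

lemma eventually_mem_target : ∀ᶠ x in nhds (φ (1 : G)), x ∈ (φ).target :=
  extChartAt_target_mem_nhds (I := 𝓘(ℂ, E)) (1 : G)

/-- A map fixing `1` is differentiated in the preferred chart at `1`. -/
lemma mfderiv_one_eq_fderiv {f : G → G} (hf : MDifferentiableAt 𝓘(ℂ, E) 𝓘(ℂ, E) f 1)
    (h1 : f 1 = 1) :
    (mfderiv 𝓘(ℂ, E) 𝓘(ℂ, E) f 1 : E →L[ℂ] E) = fderiv ℂ (φ ∘ f ∘ (φ).symm) (φ 1) := by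
  refine hf.mfderiv.trans ?_
  simp only [writtenInExtChartAt, h1, modelWithCornersSelf_coe, Set.range_id, fderivWithin_univ]
  rfl

variable [LieGroup 𝓘(ℂ, E) ω G]

lemma contMDiffAt_chart_symm {x : E} (hx : x ∈ (φ : PartialEquiv G E).target) :
    ContMDiffAt 𝓘(ℂ, E) 𝓘(ℂ, E) ω (φ : PartialEquiv G E).symm x :=
  have : IsManifold 𝓘(ℂ, E) ω G := LieGroup.toContMDiffMul.toIsManifold
  (contMDiffOn_extChartAt_symm (n := ω) (1 : G)).contMDiffAt
    ((isOpen_extChartAt_target (1 : G)).mem_nhds hx)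

lemma contDiffAt_chartMul {p : E × E} (h1 : p.1 ∈ (φ : PartialEquiv G E).target)
    (h2 : p.2 ∈ (φ : PartialEquiv G E).target)
    (h : (φ).symm p.1 * (φ).symm p.2 ∈ (φ : PartialEquiv G E).source) :
    ContDiffAt ℂ ω (chartMul E G) p := by
  have : IsManifold 𝓘(ℂ, E) ω G := LieGroup.toContMDiffMul.toIsManifold
  rw [← contMDiffAt_iff_contDiffAt]
  have a1 : ContMDiffAt 𝓘(ℂ, E × E) 𝓘(ℂ, E) ω (fun p : E × E => (φ : PartialEquiv G E).symm p.1) p :=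
    ContMDiffAt.comp p (contMDiffAt_chart_symm h1) contDiffAt_fst.contMDiffAt
  have a2 : ContMDiffAt 𝓘(ℂ, E × E) 𝓘(ℂ, E) ω (fun p : E × E => (φ : PartialEquiv G E).symm p.2) p :=
    ContMDiffAt.comp p (contMDiffAt_chart_symm h2) contDiffAt_snd.contMDiffAt
  have a3 := a1.mul a2
  rw [extChartAt_source] at h
  exact ContMDiffAt.comp p (contMDiffAt_extChartAt' h) a3

end Chart

/-! ### The adjoint action and the Lie bracket in the chart -/

section Chart

open ContinuousLinearMap

variable {E : Type*} [NormedAddCommGroup E] [NormedSpace ℂ E]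
  {G : Type*} [TopologicalSpace G] [ChartedSpace E G] [Group G]

local notation "φ" => extChartAt 𝓘(ℂ, E) (1 : G)

variable [LieGroup 𝓘(ℂ, E) ω G]

lemma mdifferentiableAt_conj (g h : G) :
    MDifferentiableAt 𝓘(ℂ, E) 𝓘(ℂ, E) (fun y : G => g * y * g⁻¹) h := by
  have h1 : ContMDiff 𝓘(ℂ, E) 𝓘(ℂ, E) ω (fun y : G => g * y * g⁻¹) :=
    (contMDiff_const.mul contMDiff_id).mul contMDiff_const
  exact (h1 h).mdifferentiableAt (by simp)

lemma mdifferentiableAt_mul_left (g h : G) :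
    MDifferentiableAt 𝓘(ℂ, E) 𝓘(ℂ, E) (fun y : G => g * y) h := by
  have h1 : ContMDiff 𝓘(ℂ, E) 𝓘(ℂ, E) ω (fun y : G => g * y) := contMDiff_const.mul contMDiff_id
  exact (h1 h).mdifferentiableAt (by simp)

lemma contDiffAt_chartMul_left {x : E} (hx : x ∈ (φ : PartialEquiv G E).target) :
    ContDiffAt ℂ ω (chartMul E G) (φ (1 : G), x) := by
  refine contDiffAt_chartMul (mem_extChartAt_target (1 : G)) hx ?_
  simp only [chart_symm_one, one_mul]
  exact PartialEquiv.map_target _ hx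

lemma contDiffAt_chartMul_right {x : E} (hx : x ∈ (φ : PartialEquiv G E).target) :
    ContDiffAt ℂ ω (chartMul E G) (x, φ (1 : G)) := by
  refine contDiffAt_chartMul hx (mem_extChartAt_target (1 : G)) ?_
  simp only [chart_symm_one, mul_one]
  exact PartialEquiv.map_target _ hx

lemma hasFDerivAt_chartMul_fst {x : E} (hx : x ∈ (φ : PartialEquiv G E).target) :
    HasFDerivAt (fun y => chartMul E G (y, x))
      ((fderiv ℂ (chartMul E G) (φ (1 : G), x)).comp (inl ℂ E E)) (φ (1 : G)) :=
  HasFDerivAt.comp (f := fun y : E => (y, x)) _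
    ((contDiffAt_chartMul_left hx).differentiableAt (by simp)).hasFDerivAt
    (hasFDerivAt_prodMk_left _ _)

lemma hasFDerivAt_chartMul_snd {x : E} (hx : x ∈ (φ : PartialEquiv G E).target) :
    HasFDerivAt (fun y => chartMul E G (x, y))
      ((fderiv ℂ (chartMul E G) (x, φ (1 : G))).comp (inr ℂ E E)) (φ (1 : G)) :=
  HasFDerivAt.comp (f := fun y : E => (x, y)) _
    ((contDiffAt_chartMul_right hx).differentiableAt (by simp)).hasFDerivAt
    (hasFDerivAt_prodMk_right _ _)

lemma fderiv_chartMul_one :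
    (fderiv ℂ (chartMul E G) (φ (1 : G), φ (1 : G))).comp (inl ℂ E E) = .id ℂ E := by
  refine (hasFDerivAt_chartMul_fst (G := G) (mem_extChartAt_target (1 : G))).unique ?_
  refine (hasFDerivAt_id (φ (1 : G))).congr_of_eventuallyEq ?_
  filter_upwards [eventually_mem_target (E := E) (G := G)] with y hy
  simp only [chartMul, chart_symm_one, mul_one]
  exact PartialEquiv.right_inv _ hy

omit [LieGroup 𝓘(ℂ, E) ω G] in
lemma Ad_one : (Ad (1 : G) : E →L[ℂ] E) = .id ℂ E := by
  have h : (fun y : G => 1 * y * 1⁻¹) = id := by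
    ext y
    simp
  have h2 : (Ad (1 : G) : E →L[ℂ] E) = mfderiv 𝓘(ℂ, E) 𝓘(ℂ, E) (id : G → G) 1 := by
    rw [← h]
    rfl
  rw [h2, mfderiv_id]
  rfl

lemma conj_chart (g : G) : HasFDerivAt (φ ∘ (fun y : G => g * y * g⁻¹) ∘ (φ).symm)
    (Ad g : E →L[ℂ] E) (φ (1 : G)) := by
  have h1 : g * 1 * g⁻¹ = 1 := by simp
  have h := mfderiv_one_eq_fderiv (mdifferentiableAt_conj (E := E) g 1) h1
  have hd := (mdifferentiableAt_conj (E := E) g 1).differentiableWithinAt_writtenInExtChartAt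
  simp only [writtenInExtChartAt, h1, modelWithCornersSelf_coe, Set.range_id,
    differentiableWithinAt_univ] at hd
  have h2 : (Ad g : E →L[ℂ] E) = fderiv ℂ (φ ∘ (fun y : G => g * y * g⁻¹) ∘ (φ).symm) (φ (1 : G)) := h
  rw [h2]
  exact hd.hasFDerivAt

/-- Left translation is right translation after conjugation, in the chart. -/
lemma partial_snd_eq_partial_fst_comp_Ad {x : E} (hx : x ∈ (φ : PartialEquiv G E).target) :
    (fderiv ℂ (chartMul E G) (x, φ (1 : G))).comp (inr ℂ E E) =
      ((fderiv ℂ (chartMul E G) (φ (1 : G), x)).comp (inl ℂ E E)).comp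
        (Ad ((φ).symm x : G) : E →L[ℂ] E) := by
  set g : G := (φ).symm x with hg
  have hc := conj_chart (E := E) g
  have hval : (φ ∘ (fun y : G => g * y * g⁻¹) ∘ (φ).symm) (φ (1 : G)) = φ (1 : G) := by
    simp
  refine (hasFDerivAt_chartMul_snd hx).unique ?_
  -- Differentiates $gy=(gyg^{-1})g$ at $y=1$.
  have hcomp := HasFDerivAt.comp (f := φ ∘ (fun y : G => g * y * g⁻¹) ∘ (φ).symm)
    (g := fun y => chartMul E G (y, x)) (φ (1 : G))
    (by rw [hval]; exact hasFDerivAt_chartMul_fst hx) hc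
  refine hcomp.congr_of_eventuallyEq ?_
  have hcont : ContinuousAt ((fun y : G => g * y * g⁻¹) ∘ (φ).symm) (φ (1 : G)) := by
    refine ContinuousAt.comp ?_ (continuousAt_extChartAt_symm (1 : G))
    exact (mdifferentiableAt_conj (E := E) g _).continuousAt
  have hmem : ∀ᶠ y in nhds (φ (1 : G)),
      ((fun y : G => g * y * g⁻¹) ∘ (φ).symm) y ∈ (φ : PartialEquiv G E).source := by
    refine hcont ?_
    simp only [Function.comp_apply, chart_symm_one, mul_one, mul_inv_cancel]
    exact extChartAt_source_mem_nhds (1 : G)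
  filter_upwards [hmem] with y hy
  simp only [Function.comp_apply, chartMul] at hy ⊢
  rw [PartialEquiv.left_inv _ hy, ← hg]
  simp

/-- In the chart at `1`, the derivative of `Ad` is the bracket of the chart multiplication. -/
lemma hasFDerivAt_Ad_chart [CompleteSpace E] :
    HasFDerivAt (fun x => (Ad ((φ).symm x : G) : E →L[ℂ] E))
      (localBracket (chartMul E G) (φ (1 : G))) (φ (1 : G)) := by
  refine hasFDerivAt_of_partial_eq (contDiffAt_chartMul_left (mem_extChartAt_target (1 : G)))
    fderiv_chartMul_one ?_ ?_
  · rw [chart_symm_one, Ad_one]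
  · filter_upwards [eventually_mem_target (E := E) (G := G)] with x hx
    exact partial_snd_eq_partial_fst_comp_Ad hx

/-- Identifies the left-invariant frame, read in the chart, with the second partial derivative of
`chartMul`. -/
lemma mfderiv_chart_comp_mul_left {x : E} (hx : x ∈ (φ : PartialEquiv G E).target) :
    (mfderiv 𝓘(ℂ, E) 𝓘(ℂ, E) φ ((φ).symm x : G) : E →L[ℂ] E).comp
      (mfderiv 𝓘(ℂ, E) 𝓘(ℂ, E) (fun y : G => (φ).symm x * y) 1 : E →L[ℂ] E) =
    (fderiv ℂ (chartMul E G) (x, φ (1 : G))).comp (inr ℂ E E) := by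
  have : IsManifold 𝓘(ℂ, E) ω G := LieGroup.toContMDiffMul.toIsManifold
  have : IsManifold 𝓘(ℂ, E) 1 G := .of_le (n := ω) le_top
  have hs : (φ).symm x ∈ (chartAt E (1 : G)).source := by
    simpa using PartialEquiv.map_target _ hx
  set g : G := (φ).symm x with hg
  let F : G → (E →L[ℂ] E) := fun h => mfderiv 𝓘(ℂ, E) 𝓘(ℂ, E) φ h
  have e : F g = F (g * 1) := by rw [mul_one]
  have hφ : MDifferentiableAt 𝓘(ℂ, E) 𝓘(ℂ, E) φ (g * 1) :=
    mdifferentiableAt_extChartAt (by rwa [mul_one])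
  have hcomp := mfderiv_comp (1 : G) hφ (mdifferentiableAt_mul_left (E := E) g 1)
  have hd := (hφ.comp (1 : G) (mdifferentiableAt_mul_left (E := E) g 1)).mfderiv
  rw [hcomp] at hd
  refine (congrArg (fun T => T.comp
    (mfderiv 𝓘(ℂ, E) 𝓘(ℂ, E) (fun y : G => g * y) 1 : E →L[ℂ] E)) e).trans (Eq.trans hd ?_)
  simp only [writtenInExtChartAt, modelWithCornersSelf_coe, Set.range_id, fderivWithin_univ]
  exact (hasFDerivAt_chartMul_snd hx).fderiv

lemma mpullbackWithin_mulInvariantVectorField {x : E} (hx : x ∈ (φ : PartialEquiv G E).target)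
    (v : LieAlg E G) :
    VectorField.mpullbackWithin 𝓘(ℂ, E) 𝓘(ℂ, E) (φ : PartialEquiv G E).symm
      (mulInvariantVectorField v) (Set.range 𝓘(ℂ, E)) x =
    (fderiv ℂ (chartMul E G) (x, φ (1 : G))).comp (inr ℂ E E) v := by
  have : IsManifold 𝓘(ℂ, E) ω G := LieGroup.toContMDiffMul.toIsManifold
  have : IsManifold 𝓘(ℂ, E) 1 G := .of_le (n := ω) le_top
  rw [VectorField.mpullbackWithin_apply,
    ContinuousLinearMap.inverse_eq (mfderivWithin_extChartAt_symm_comp_mfderiv_extChartAt hx)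
      (mfderiv_extChartAt_comp_mfderivWithin_extChartAt_symm hx),
    ← mfderiv_chart_comp_mul_left hx]
  rfl

/-- The Lie bracket of the Lie algebra of `G` is the bracket of the chart multiplication. -/
lemma lie_eq_localBracket (u v : LieAlg E G) :
    ⁅u, v⁆ = localBracket (chartMul E G) (φ (1 : G)) u v := by
  have : IsManifold 𝓘(ℂ, E) ω G := LieGroup.toContMDiffMul.toIsManifold
  have : IsManifold 𝓘(ℂ, E) 1 G := .of_le (n := ω) le_top
  have hm := contDiffAt_chartMul_left (E := E) (G := G) (mem_extChartAt_target (1 : G))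
  have hV : ∀ v : LieAlg E G, VectorField.mpullbackWithin 𝓘(ℂ, E) 𝓘(ℂ, E)
      (φ : PartialEquiv G E).symm (mulInvariantVectorField v) (Set.range 𝓘(ℂ, E)) =ᶠ[nhds (φ 1)]
      fun x => (fderiv ℂ (chartMul E G) (x, φ (1 : G))).comp (inr ℂ E E) v := by
    intro v
    filter_upwards [eventually_mem_target (E := E) (G := G)] with x hx
    exact mpullbackWithin_mulInvariantVectorField hx v
  have hN1 : (fderiv ℂ (chartMul E G) (φ (1 : G), φ (1 : G))).comp (inr ℂ E E) = .id ℂ E := by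
    have h := partial_snd_eq_partial_fst_comp_Ad (E := E) (G := G) (mem_extChartAt_target (1 : G))
    rw [h, chart_symm_one, Ad_one, fderiv_chartMul_one]
    rfl
  have hD : ∀ v : E, fderiv ℂ
      (fun x => (fderiv ℂ (chartMul E G) (x, φ (1 : G))).comp (inr ℂ E E) v) (φ (1 : G)) =
      (fderiv ℂ (fun x => (fderiv ℂ (chartMul E G) (x, φ (1 : G))).comp (inr ℂ E E))
        (φ (1 : G))).flip v := by
    intro v
    ext w
    rw [fderiv_clm_apply (hasFDerivAt_partial_snd hm).differentiableAt
      (differentiableAt_const v)]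
    simp
  -- The bracket depends only on germs, so the chart expression of the left-invariant fields may
  -- replace the pulled-back fields near the unit.
  have key : ∀ (u v : E) (U W : E → E),
      U =ᶠ[nhds (φ (1 : G))]
        (fun x => (fderiv ℂ (chartMul E G) (x, φ (1 : G))).comp (inr ℂ E E) u) →
      W =ᶠ[nhds (φ (1 : G))]
        (fun x => (fderiv ℂ (chartMul E G) (x, φ (1 : G))).comp (inr ℂ E E) v) →
      VectorField.lieBracketWithin ℂ U W Set.univ (φ (1 : G)) =
        fderiv ℂ (fun x => (fderiv ℂ (chartMul E G) (x, φ (1 : G))).comp (inr ℂ E E))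
          (φ (1 : G)) u v -
        fderiv ℂ (fun x => (fderiv ℂ (chartMul E G) (x, φ (1 : G))).comp (inr ℂ E E))
          (φ (1 : G)) v u := by
    intro u v U W hU hW
    rw [VectorField.lieBracketWithin_univ, VectorField.lieBracket_eq]
    simp only
    rw [hU.fderiv_eq, hW.fderiv_eq, hU.eq_of_nhds, hW.eq_of_nhds, hN1, hD, hD]
    rfl
  have hid : ∀ w : E, (ContinuousLinearMap.id ℂ E).inverse w = w := fun w => by
    rw [ContinuousLinearMap.inverse_id, ContinuousLinearMap.id_apply]
  refine Eq.trans ?_ (localBracket_apply hm u v).symm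
  rw [GroupLieAlgebra.bracket_def, VectorField.mlieBracket,
    VectorField.mlieBracketWithin_apply, mfderiv_extChartAt_self]
  refine Eq.trans (hid _) ?_
  simp only [modelWithCornersSelf_coe, Set.range_id, Set.preimage_univ, Set.univ_inter] at hV ⊢
  refine key u v _ _ (hV u) (hV v)

end Chart

/-! ### Chain rule between model spaces; functions with zero derivative -/

section Derivative

variable {E : Type*} [NormedAddCommGroup E] [NormedSpace ℂ E]
  {E₁ : Type*} [NormedAddCommGroup E₁] [NormedSpace ℂ E₁]
  {E₂ : Type*} [NormedAddCommGroup E₂] [NormedSpace ℂ E₂]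

/-- The derivative of a map between manifolds, as a map between the model spaces. -/
def modelDeriv {M M₁ : Type*} [TopologicalSpace M] [ChartedSpace E M]
    [TopologicalSpace M₁] [ChartedSpace E₁ M₁] (f : M → M₁) (x : M) : E →L[ℂ] E₁ :=
  mfderiv 𝓘(ℂ, E) 𝓘(ℂ, E₁) f x

/-- The chain rule, with derivatives as maps between the model spaces. -/
lemma modelDeriv_comp {M M₁ M₂ : Type*} [TopologicalSpace M] [ChartedSpace E M]
    [TopologicalSpace M₁] [ChartedSpace E₁ M₁] [TopologicalSpace M₂] [ChartedSpace E₂ M₂]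
    {f : M → M₁} {g : M₁ → M₂} {x : M} {y : M₁} (hy : f x = y)
    (hg : MDifferentiableAt 𝓘(ℂ, E₁) 𝓘(ℂ, E₂) g y) (hf : MDifferentiableAt 𝓘(ℂ, E) 𝓘(ℂ, E₁) f x) :
    (modelDeriv (fun z => g (f z)) x : E →L[ℂ] E₂) =
      (modelDeriv g y : E₁ →L[ℂ] E₂).comp (modelDeriv f x : E →L[ℂ] E₁) := by
  subst hy
  exact mfderiv_comp x hg hf

/-- A function with vanishing derivative on a connected complex manifold is constant. -/
lemma eq_of_hasMFDerivAt_zero {M : Type*} [TopologicalSpace M] [ChartedSpace E M]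
    [IsManifold 𝓘(ℂ, E) 1 M] [PreconnectedSpace M] {F : M → ℂ}
    (hF : ∀ a, HasMFDerivAt 𝓘(ℂ, E) 𝓘(ℂ, ℂ) F a 0) (a b : M) : F a = F b := by
  have hloc : IsLocallyConstant F := by
    rw [IsLocallyConstant.iff_eventually_eq]
    intro a
    set ψ := extChartAt 𝓘(ℂ, E) a with hψ
    obtain ⟨r, hr, hball⟩ := Metric.isOpen_iff.mp (isOpen_extChartAt_target (I := 𝓘(ℂ, E)) a)
      (ψ a) (mem_extChartAt_target a)
    have hder : ∀ x ∈ Metric.ball (ψ a) r, HasFDerivAt (F ∘ ψ.symm) (0 : E →L[ℂ] ℂ) x := by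
      intro x hx
      have h1 : MDifferentiableAt 𝓘(ℂ, E) 𝓘(ℂ, E) ψ.symm x :=
        ((contMDiffOn_extChartAt_symm (n := 1) a).contMDiffAt
          ((isOpen_extChartAt_target a).mem_nhds (hball hx))).mdifferentiableAt (by simp)
      have h2 := (hF (ψ.symm x)).comp x h1.hasMFDerivAt
      have h3 := h2.hasFDerivAt
      refine h3.congr_fderiv ?_
      exact ContinuousLinearMap.zero_comp _
    have hconst : ∀ x ∈ Metric.ball (ψ a) r, (F ∘ ψ.symm) x = (F ∘ ψ.symm) (ψ a) := by
      intro x hx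
      refine Metric.isOpen_ball.is_const_of_fderiv_eq_zero (𝕜 := ℂ)
        (convex_ball (ψ a) r).isPreconnected
        (fun y hy => (hder y hy).differentiableAt.differentiableWithinAt)
        (fun y hy => (hder y hy).fderiv) hx (Metric.mem_ball_self hr)
    have hcont : ContinuousAt ψ a := continuousAt_extChartAt a
    filter_upwards [extChartAt_source_mem_nhds (I := 𝓘(ℂ, E)) a,
      hcont (Metric.ball_mem_nhds _ hr)] with b hb hb'
    have := hconst (ψ b) hb'
    simp only [Function.comp_apply] at this
    rwa [ψ.left_inv hb, ψ.left_inv (mem_extChartAt_source a)] at this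
  exact hloc.apply_eq_of_preconnectedSpace a b

end Derivative

/-! ### The adjoint action as a representation; derivatives of products -/

section Group

variable {E : Type*} [NormedAddCommGroup E] [NormedSpace ℂ E]
  {G : Type*} [TopologicalSpace G] [ChartedSpace E G] [Group G]
  {E₁ : Type*} [NormedAddCommGroup E₁] [NormedSpace ℂ E₁]
  {G₁ : Type*} [TopologicalSpace G₁] [ChartedSpace E₁ G₁] [Group G₁]
  {V : Type*} [NormedAddCommGroup V] [NormedSpace ℂ V]

local notation "φ" => extChartAt 𝓘(ℂ, E) (1 : G)
local notation "φ₁" => extChartAt 𝓘(ℂ, E₁) (1 : G₁)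

lemma hasFDerivAt_lieMap {ι : G₁ →* G}
    (hι : MDifferentiableAt 𝓘(ℂ, E₁) 𝓘(ℂ, E) (fun y => ι y) 1) :
    HasFDerivAt (φ ∘ (fun y => ι y) ∘ (φ₁).symm) (lieMap ι : E₁ →L[ℂ] E) (φ₁ 1) := by
  have h1 : ι 1 = 1 := map_one ι
  have hd := hι.differentiableWithinAt_writtenInExtChartAt
  have he : (lieMap ι : E₁ →L[ℂ] E) =
      fderivWithin ℂ (writtenInExtChartAt 𝓘(ℂ, E₁) 𝓘(ℂ, E) 1 (fun y => ι y))
        (Set.range 𝓘(ℂ, E₁)) (φ₁ 1) := hι.mfderiv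
  simp only [writtenInExtChartAt, h1, modelWithCornersSelf_coe, Set.range_id,
    differentiableWithinAt_univ, fderivWithin_univ] at hd he
  rw [he]
  exact hd.hasFDerivAt

/-- The derivative of a map from a vector space at a point mapped to `1`. -/
lemma hasFDerivAt_chart_comp {f : V → G} {x : V} (hf : MDifferentiableAt 𝓘(ℂ, V) 𝓘(ℂ, E) f x)
    (h1 : f x = 1) :
    HasFDerivAt (φ ∘ f) (modelDeriv f x : V →L[ℂ] E) x := by
  have hd := hf.differentiableWithinAt_writtenInExtChartAt
  have he : (modelDeriv f x : V →L[ℂ] E) =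
      fderivWithin ℂ (writtenInExtChartAt 𝓘(ℂ, V) 𝓘(ℂ, E) x f) (Set.range 𝓘(ℂ, V))
        (extChartAt 𝓘(ℂ, V) x x) := hf.mfderiv
  simp only [writtenInExtChartAt, h1, modelWithCornersSelf_coe, Set.range_id,
    differentiableWithinAt_univ, fderivWithin_univ, extChartAt_model_space_eq_id,
    PartialEquiv.refl_symm, PartialEquiv.refl_coe, Function.comp_id, id_eq] at hd he
  rw [he]
  exact hd.hasFDerivAt

lemma hasMFDerivAt_one_of_chart {F : G₁ → V} {D : E₁ →L[ℂ] V}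
    (hF : HasFDerivAt (fun x => F ((φ₁).symm x)) D (φ₁ 1)) :
    HasMFDerivAt 𝓘(ℂ, E₁) 𝓘(ℂ, V) F (1 : G₁) D := by
  refine ⟨?_, ?_⟩
  · have h : ContinuousAt (fun y => F ((φ₁).symm (φ₁ y))) (1 : G₁) :=
      ContinuousAt.comp (f := φ₁) (g := fun x => F ((φ₁).symm x)) hF.continuousAt
        (continuousAt_extChartAt (1 : G₁))
    refine h.congr ?_
    filter_upwards [extChartAt_source_mem_nhds (I := 𝓘(ℂ, E₁)) (1 : G₁)] with y hy
    rw [PartialEquiv.left_inv _ hy]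
  · exact hF.hasFDerivWithinAt

variable [LieGroup 𝓘(ℂ, E) ω G]

lemma Ad_mul (g h : G) : (Ad (g * h) : E →L[ℂ] E) =
    (Ad g : E →L[ℂ] E).comp (Ad h : E →L[ℂ] E) := by
  have h1 : h * 1 * h⁻¹ = 1 := by simp
  have := modelDeriv_comp (f := fun y : G => h * y * h⁻¹) (g := fun y : G => g * y * g⁻¹)
    h1 (mdifferentiableAt_conj (E := E) g 1) (mdifferentiableAt_conj (E := E) h 1)
  refine Eq.trans ?_ this
  have h2 : (fun y : G => g * h * y * (g * h)⁻¹) = fun y => g * (h * y * h⁻¹) * g⁻¹ := by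
    ext y
    group
  rw [← h2]
  rfl

lemma Ad_mul_apply (g h : G) (v : LieAlg E G) : Ad (g * h) v = Ad g (Ad h v) :=
  congrArg (fun T : E →L[ℂ] E => T v) (Ad_mul g h)

omit [LieGroup 𝓘(ℂ, E) ω G] in
lemma Ad_one_apply (v : LieAlg E G) : Ad (1 : G) v = v :=
  congrArg (fun T : E →L[ℂ] E => T v) Ad_one

lemma Ad2_mul_apply (g h : G) (z : LieAlg E G ⊗[ℂ] LieAlg E G) :
    Ad2 (g * h) z = Ad2 g (Ad2 h z) := by
  induction z with
  | zero => simp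
  | tmul a b =>
    change Ad (g * h) a ⊗ₜ[ℂ] Ad (g * h) b = Ad g (Ad h a) ⊗ₜ[ℂ] Ad g (Ad h b)
    rw [Ad_mul_apply, Ad_mul_apply]
  | add a b ha hb => simp only [map_add, ha, hb]

omit [LieGroup 𝓘(ℂ, E) ω G] in
lemma Ad2_one_apply (z : LieAlg E G ⊗[ℂ] LieAlg E G) : Ad2 (1 : G) z = z := by
  induction z with
  | zero => simp
  | tmul a b =>
    change Ad (1 : G) a ⊗ₜ[ℂ] Ad (1 : G) b = _
    rw [Ad_one_apply, Ad_one_apply]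
  | add a b ha hb => simp only [map_add, ha, hb]

lemma Ad2_injective (g : G) : Function.Injective (Ad2 (E := E) g) := by
  intro z w h
  have h' := congrArg (Ad2 g⁻¹) h
  rwa [← Ad2_mul_apply, ← Ad2_mul_apply, inv_mul_cancel, Ad2_one_apply, Ad2_one_apply] at h'

/-- The derivative at `1` of a product of two maps with value `1`. -/
lemma modelDeriv_mul_of_eq_one {f h : V → G} {x : V}
    (hf : MDifferentiableAt 𝓘(ℂ, V) 𝓘(ℂ, E) f x) (hh : MDifferentiableAt 𝓘(ℂ, V) 𝓘(ℂ, E) h x)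
    (hf1 : f x = 1) (hh1 : h x = 1) :
    (modelDeriv (fun y => f y * h y) x : V →L[ℂ] E) =
      (modelDeriv f x : V →L[ℂ] E) +
        (modelDeriv h x : V →L[ℂ] E) := by
  have hmul : MDifferentiableAt 𝓘(ℂ, V) 𝓘(ℂ, E) (fun y => f y * h y) x := by
    have hm := ((contMDiff_mul 𝓘(ℂ, E) ω (G := G)) (f x, h x)).mdifferentiableAt (by simp)
    exact MDifferentiableAt.comp x hm (hf.prodMk hh)
  have d := hasFDerivAt_chart_comp hmul (by simp [hf1, hh1])
  have df := hasFDerivAt_chart_comp hf hf1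
  have dh := hasFDerivAt_chart_comp hh hh1
  have ho : (φ : PartialEquiv G E) 1 ∈ (φ : PartialEquiv G E).target := mem_extChartAt_target (1 : G)
  have hm := ((contDiffAt_chartMul_left (E := E) (G := G) ho).differentiableAt (by simp)).hasFDerivAt
  have hN1 : (fderiv ℂ (chartMul E G) (φ (1 : G), φ (1 : G))).comp
      (ContinuousLinearMap.inr ℂ E E) = .id ℂ E := by
    rw [partial_snd_eq_partial_fst_comp_Ad (E := E) (G := G) ho, chart_symm_one, Ad_one,
      fderiv_chartMul_one]
    rfl
  have hc : HasFDerivAt (fun y => chartMul E G (φ (f y), φ (h y)))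
      ((fderiv ℂ (chartMul E G) (φ (1 : G), φ (1 : G))).comp
        ((modelDeriv f x : V →L[ℂ] E).prod
          (modelDeriv h x : V →L[ℂ] E))) x := by
    refine HasFDerivAt.comp (g := chartMul E G) (f := fun y => (φ (f y), φ (h y))) x ?_
      (df.prodMk dh)
    simpa [hf1, hh1] using hm
  have hev : (φ ∘ fun y => f y * h y) =ᶠ[nhds x] fun y => chartMul E G (φ (f y), φ (h y)) := by
    have hs : ∀ k : V → G, ContinuousAt k x → k x = 1 →
        ∀ᶠ y in nhds x, k y ∈ (φ : PartialEquiv G E).source := fun k hk hk1 =>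
      hk (hk1 ▸ extChartAt_source_mem_nhds (1 : G))
    filter_upwards [hs f hf.continuousAt hf1, hs h hh.continuousAt hh1] with y hy1 hy2
    simp only [chartMul, Function.comp_apply]
    rw [PartialEquiv.left_inv _ hy1, PartialEquiv.left_inv _ hy2]
  -- At the unit both partial derivatives of `chartMul` are the identity, so its total derivative is
  -- addition.
  refine (d.unique (hc.congr_of_eventuallyEq hev)).trans ?_
  ext v
  have e1 := congrArg (fun T : E →L[ℂ] E => T ((modelDeriv f x : V →L[ℂ] E) v))
    (fderiv_chartMul_one (E := E) (G := G))
  have e2 := congrArg (fun T : E →L[ℂ] E => T ((modelDeriv h x : V →L[ℂ] E) v)) hN1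
  simp only [ContinuousLinearMap.comp_apply, ContinuousLinearMap.inl_apply,
    ContinuousLinearMap.inr_apply, ContinuousLinearMap.id_apply,
    add_apply, ContinuousLinearMap.prod_apply] at e1 e2 ⊢
  refine Eq.trans ?_ (congrArg₂ (· + ·) e1 e2)
  rw [← map_add]
  simp

end Group

/-! ### Homomorphisms of Lie groups: from infinitesimal to group invariance -/

section Group

variable {E : Type*} [NormedAddCommGroup E] [NormedSpace ℂ E] [FiniteDimensional ℂ E]
  {G : Type*} [TopologicalSpace G] [ChartedSpace E G] [Group G]
  {E₁ : Type*} [NormedAddCommGroup E₁] [NormedSpace ℂ E₁] [FiniteDimensional ℂ E₁]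
  {G₁ : Type*} [TopologicalSpace G₁] [ChartedSpace E₁ G₁] [Group G₁]
  [LieGroup 𝓘(ℂ, E) ω G] [LieGroup 𝓘(ℂ, E₁) ω G₁]

local notation "φ" => extChartAt 𝓘(ℂ, E) (1 : G)
local notation "φ₁" => extChartAt 𝓘(ℂ, E₁) (1 : G₁)

variable (G) in
/-- The bracket of the Lie algebra of `G` as a continuous bilinear map on the model space. -/
def lieBracketL : E →L[ℂ] E →L[ℂ] E := localBracket (chartMul E G) (φ 1)

omit [FiniteDimensional ℂ E] in
lemma lieBracketL_apply (u v : LieAlg E G) : lieBracketL G (E := E) u v = ⁅u, v⁆ :=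
  (lie_eq_localBracket u v).symm

omit [FiniteDimensional ℂ E] [LieGroup 𝓘(ℂ, E) ω G] in
variable (E) in
/-- `Ad g` as a map of the model space. -/
def modelAd (g : G) : E →L[ℂ] E := Ad g

omit [FiniteDimensional ℂ E] [FiniteDimensional ℂ E₁] [LieGroup 𝓘(ℂ, E) ω G]
  [LieGroup 𝓘(ℂ, E₁) ω G₁] in
variable (E E₁) in
/-- The differential at `1` of a homomorphism, as a map of the model spaces. -/
def modelLieMap (ι : G₁ →* G) : E₁ →L[ℂ] E := lieMap ι

variable {ι : G₁ →* G}

omit [FiniteDimensional ℂ E₁] [LieGroup 𝓘(ℂ, E₁) ω G₁] in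
lemma hasFDerivAt_Ad_comp (hι : MDifferentiableAt 𝓘(ℂ, E₁) 𝓘(ℂ, E) (fun y => ι y) 1) :
    HasFDerivAt (fun x => modelAd E (ι ((φ₁).symm x)))
      ((lieBracketL G).comp (modelLieMap E E₁ ι)) (φ₁ 1) := by
  have : CompleteSpace E := FiniteDimensional.complete ℂ E
  have h1 := hasFDerivAt_lieMap hι
  have hval : (φ ∘ (fun y => ι y) ∘ (φ₁).symm) (φ₁ 1) = φ (1 : G) := by simp
  have h2 := HasFDerivAt.comp (f := φ ∘ (fun y => ι y) ∘ (φ₁).symm)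
    (g := fun x => modelAd E ((φ).symm x : G)) (φ₁ (1 : G₁))
    (by rw [hval]; exact hasFDerivAt_Ad_chart) h1
  refine h2.congr_of_eventuallyEq ?_
  have hcont : ContinuousAt ((fun y => ι y) ∘ (φ₁).symm) (φ₁ (1 : G₁)) := by
    refine ContinuousAt.comp ?_ (continuousAt_extChartAt_symm (1 : G₁))
    rw [chart_symm_one]
    exact hι.continuousAt
  have hmem : ∀ᶠ x in nhds (φ₁ (1 : G₁)),
      ((fun y => ι y) ∘ (φ₁).symm) x ∈ (φ : PartialEquiv G E).source := by
    refine hcont ?_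
    simp only [Function.comp_apply, chart_symm_one, map_one]
    exact extChartAt_source_mem_nhds (1 : G)
  filter_upwards [hmem] with x hx
  simp only [Function.comp_apply] at hx ⊢
  rw [PartialEquiv.left_inv _ hx]

-- The chain rule applied to $\iota(aya^{-1})=\iota(a)\iota(y)\iota(a)^{-1}$. Differentiating once
-- more, in $a$ at $1$, gives `lieMap_lie`.
omit [FiniteDimensional ℂ E] [FiniteDimensional ℂ E₁] in
lemma lieMap_Ad (hι : MDifferentiableAt 𝓘(ℂ, E₁) 𝓘(ℂ, E) (fun y => ι y) 1) (a : G₁) :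
    (modelLieMap E E₁ ι).comp (modelAd E₁ a) =
      (modelAd E (ι a)).comp (modelLieMap E E₁ ι) := by
  have h1 := modelDeriv_comp (f := fun y : G₁ => a * y * a⁻¹) (g := fun y => ι y) (x := 1)
    (y := 1) (by simp) hι (mdifferentiableAt_conj a 1)
  have h2 := modelDeriv_comp (f := fun y => ι y) (g := fun y : G => ι a * y * (ι a)⁻¹) (x := 1)
    (y := 1) (by simp) (mdifferentiableAt_conj (ι a) 1) hι
  refine h1.symm.trans (Eq.trans ?_ h2)
  simp only [map_mul, map_inv]

/-- The differential at `1` of a homomorphism of Lie groups preserves brackets. -/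
lemma lieMap_lie (hι : MDifferentiableAt 𝓘(ℂ, E₁) 𝓘(ℂ, E) (fun y => ι y) 1)
    (u v : LieAlg E₁ G₁) : lieMap (E := E) ι ⁅u, v⁆ = ⁅lieMap (E := E) ι u, lieMap (E := E) ι v⁆ := by
  have : CompleteSpace E₁ := FiniteDimensional.complete ℂ E₁
  have h1 : HasFDerivAt
      (fun x => (modelLieMap E E₁ ι).comp (modelAd E₁ ((φ₁).symm x : G₁)))
      ((ContinuousLinearMap.compL ℂ E₁ E₁ E (modelLieMap E E₁ ι)).comp (lieBracketL G₁)) (φ₁ (1 : G₁)) :=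
    (ContinuousLinearMap.compL ℂ E₁ E₁ E (modelLieMap E E₁ ι)).hasFDerivAt.comp _ hasFDerivAt_Ad_chart
  have h2 : HasFDerivAt
      (fun x => (modelAd E (ι ((φ₁).symm x))).comp (modelLieMap E E₁ ι))
      (((ContinuousLinearMap.compL ℂ E₁ E E).flip (modelLieMap E E₁ ι)).comp
        ((lieBracketL G).comp (modelLieMap E E₁ ι))) (φ₁ (1 : G₁)) :=
    ((ContinuousLinearMap.compL ℂ E₁ E E).flip (modelLieMap E E₁ ι)).hasFDerivAt.comp _
      (hasFDerivAt_Ad_comp hι)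
  have h3 := h1.unique (h2.congr_of_eventuallyEq (.of_forall fun x => lieMap_Ad hι _))
  have h4 := congrArg (fun T : E₁ →L[ℂ] E₁ →L[ℂ] E => T u v) h3
  have e1 : lieMap (E := E) ι ⁅u, v⁆ = lieMap (E := E) ι (lieBracketL G₁ (E := E₁) u v) :=
    congrArg (lieMap (E := E) ι) (lieBracketL_apply u v).symm
  exact e1.trans (h4.trans (lieBracketL_apply _ _))

-- The derivative of $\otimes^2\mathrm{Ad}$ at $1$ is the derivation action. Testing against
-- functionals `Φ` gives scalar functions, so no norm on the tensor product enters.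
omit [FiniteDimensional ℂ E₁] [LieGroup 𝓘(ℂ, E₁) ω G₁] in
lemma exists_hasFDerivAt_Ad2 (hι : MDifferentiableAt 𝓘(ℂ, E₁) 𝓘(ℂ, E) (fun y => ι y) 1)
    (Φ : Module.Dual ℂ (LieAlg E G ⊗[ℂ] LieAlg E G)) (s : LieAlg E G ⊗[ℂ] LieAlg E G) :
    ∃ D : E₁ →L[ℂ] ℂ, HasFDerivAt (fun x => Φ (Ad2 (ι ((φ₁).symm x)) s)) D (φ₁ (1 : G₁)) ∧
      ∀ u : E₁, D u = Φ (adTensor (lieMap (G₁ := G₁) ι u) s) := by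
  induction s with
  | zero =>
    refine ⟨0, ?_, fun u => by simp⟩
    simpa using hasFDerivAt_const (0 : ℂ) (φ₁ (1 : G₁))
  | add s s' hs hs' =>
    obtain ⟨D, hD, hDu⟩ := hs
    obtain ⟨D', hD', hDu'⟩ := hs'
    refine ⟨D + D', ?_, fun u => ?_⟩
    · simp only [map_add]
      exact hD.add hD'
    · rw [map_add, map_add, ← hDu, ← hDu']
      rfl
  | tmul a b =>
    let β : E →ₗ[ℂ] E →ₗ[ℂ] ℂ := TensorProduct.curry Φ
    let β' : E →L[ℂ] E →L[ℂ] ℂ :=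
      LinearMap.toContinuousLinearMap
        ((LinearMap.toContinuousLinearMap : (E →ₗ[ℂ] ℂ) ≃ₗ[ℂ] (E →L[ℂ] ℂ)).toLinearMap ∘ₗ β)
    have hA := hasFDerivAt_Ad_comp (E₁ := E₁) (E := E) hι
    have hv : ∀ v : E, HasFDerivAt (fun x => modelAd E (ι ((φ₁).symm x)) v)
        (((lieBracketL G).comp (modelLieMap E E₁ ι)).flip v) (φ₁ (1 : G₁)) := fun v =>
      (ContinuousLinearMap.apply ℂ E v).hasFDerivAt.comp _ hA
    have hone : ∀ v : E, modelAd E (ι ((φ₁).symm (φ₁ (1 : G₁)))) v = v := fun v => by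
      rw [chart_symm_one, map_one]
      exact Ad_one_apply v
    refine ⟨_, β'.hasFDerivAt_of_bilinear (hv a) (hv b), fun u => ?_⟩
    have h1 : β' (modelAd E (ι ((φ₁).symm (φ₁ (1 : G₁)))) a)
        (lieBracketL G (modelLieMap E E₁ ι u) b) +
        β' (lieBracketL G (modelLieMap E E₁ ι u) a)
          (modelAd E (ι ((φ₁).symm (φ₁ (1 : G₁)))) b) =
        Φ (adTensor (lieMap (G₁ := G₁) ι u) (a ⊗ₜ[ℂ] b)) := by
      refine Eq.trans (congrArg₂ (· + ·)
        (congrArg (fun c : E => β' c (lieBracketL G (modelLieMap E E₁ ι u) b)) (hone a))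
        (congrArg (fun c : E => β' (lieBracketL G (modelLieMap E E₁ ι u) a) c) (hone b))) ?_
      rw [adTensor_tmul, map_add, add_comm (Φ _), ← lieBracketL_apply, ← lieBracketL_apply]
      rfl
    exact h1

omit [FiniteDimensional ℂ E₁] in
/-- A tensor invariant under the Lie algebra of a connected group is invariant under the group. -/
lemma Ad2_eq_self_of_adTensor_eq_zero [PreconnectedSpace G₁]
    (hι : ContMDiff 𝓘(ℂ, E₁) 𝓘(ℂ, E) ω (fun y => ι y)) {s : LieAlg E G ⊗[ℂ] LieAlg E G}
    (hs : ∀ u, adTensor (lieMap (G₁ := G₁) (E₁ := E₁) ι u) s = 0) (a : G₁) : Ad2 (ι a) s = s := by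
  have : IsManifold 𝓘(ℂ, E₁) ω G₁ := LieGroup.toContMDiffMul.toIsManifold
  have : IsManifold 𝓘(ℂ, E₁) 1 G₁ := .of_le (n := ω) le_top
  have hι1 : MDifferentiableAt 𝓘(ℂ, E₁) 𝓘(ℂ, E) (fun y => ι y) 1 :=
    (hι 1).mdifferentiableAt (by simp)
  have hone : ∀ Φ : Module.Dual ℂ (LieAlg E G ⊗[ℂ] LieAlg E G),
      HasMFDerivAt 𝓘(ℂ, E₁) 𝓘(ℂ, ℂ) (fun b => Φ (Ad2 (ι b) s)) (1 : G₁) 0 := by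
    intro Φ
    obtain ⟨D, hD, hDu⟩ := exists_hasFDerivAt_Ad2 hι1 Φ s
    have hD0 : D = 0 := by
      ext u
      exact (hDu u).trans ((congrArg Φ (hs u)).trans (map_zero Φ))
    exact hasMFDerivAt_one_of_chart (hD0 ▸ hD)
  have hall : ∀ (Φ : Module.Dual ℂ (LieAlg E G ⊗[ℂ] LieAlg E G)) (a : G₁),
      HasMFDerivAt 𝓘(ℂ, E₁) 𝓘(ℂ, ℂ) (fun b => Φ (Ad2 (ι b) s)) a 0 := by
    intro Φ a
    -- Left translation moves the point from $a$ to $1$: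
    -- $\mathrm{Ad}_{\iota(b)}=\mathrm{Ad}_{\iota(a)}\mathrm{Ad}_{\iota(a^{-1}b)}$, with
    -- $\mathrm{Ad}_{\iota(a)}$ absorbed into the functional.
    have h1 := hone (Φ ∘ₗ Ad2 (ι a))
    have h2 : MDifferentiableAt 𝓘(ℂ, E₁) 𝓘(ℂ, E₁) (fun b : G₁ => a⁻¹ * b) a :=
      mdifferentiableAt_mul_left a⁻¹ a
    have h3 : HasMFDerivAt 𝓘(ℂ, E₁) 𝓘(ℂ, ℂ) (fun b => (Φ ∘ₗ Ad2 (ι a)) (Ad2 (ι b) s))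
        (a⁻¹ * a) 0 := by
      rw [inv_mul_cancel]
      exact h1
    have h4 := h3.comp a h2.hasMFDerivAt
    have h5 : ((fun b => (Φ ∘ₗ Ad2 (ι a)) (Ad2 (ι b) s)) ∘ fun b : G₁ => a⁻¹ * b) =
        fun b => Φ (Ad2 (ι b) s) := by
      funext b
      simp only [Function.comp_apply, LinearMap.comp_apply]
      rw [← Ad2_mul_apply, ← map_mul, mul_inv_cancel_left]
    rw [h5] at h4
    convert! h4 using 1
  have hconst : ∀ Φ : Module.Dual ℂ (LieAlg E G ⊗[ℂ] LieAlg E G), Φ (Ad2 (ι a) s) = Φ s := by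
    intro Φ
    have := eq_of_hasMFDerivAt_zero (hall Φ) a 1
    rwa [map_one, Ad2_one_apply] at this
  have := (Module.forall_dual_apply_eq_zero_iff ℂ (Ad2 (ι a) s - s)).mp fun Φ => by
    rw [map_sub, hconst, sub_self]
  exact sub_eq_zero.mp this

end Group

/-! ### The product formula for gauge transforms -/

section Group

variable {E : Type*} [NormedAddCommGroup E] [NormedSpace ℂ E] [FiniteDimensional ℂ E]
  {G : Type*} [TopologicalSpace G] [ChartedSpace E G] [Group G]
  {E₁ : Type*} [NormedAddCommGroup E₁] [NormedSpace ℂ E₁] [FiniteDimensional ℂ E₁]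
  {G₁ : Type*} [TopologicalSpace G₁] [ChartedSpace E₁ G₁] [Group G₁]
  {ι : G₁ →* G}

variable (ι) in
/-- The projection `𝔤* → 𝔤₁*` as a continuous linear map. -/
def dualProjL : StrongDual ℂ E →L[ℂ] StrongDual ℂ E₁ :=
  (ContinuousLinearMap.compL ℂ E₁ E ℂ).flip (modelLieMap E E₁ ι)

-- A left inverse of the injective differential extends functionals, so the projection is surjective
-- and the open mapping theorem applies. Hence $p(D)$ is open, and holomorphy of $\rho_1$ on it is
-- differentiability at each point.
omit [FiniteDimensional ℂ E₁] in
lemma isOpenMap_dualProj (hι : Function.Injective (lieMap (E := E) (E₁ := E₁) ι)) :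
    IsOpenMap (dualProj (G := G) (E := E) (E₁ := E₁) ι) := by
  have : CompleteSpace E := FiniteDimensional.complete ℂ E
  have hsurj : Function.Surjective (dualProjL (E := E) (E₁ := E₁) ι) := by
    intro ξ
    have hker : LinearMap.ker (modelLieMap E E₁ ι).toLinearMap = ⊥ := LinearMap.ker_eq_bot.mpr hι
    obtain ⟨s, hs⟩ := LinearMap.exists_leftInverse_of_injective _ hker
    refine ⟨ξ.comp (LinearMap.toContinuousLinearMap s), ?_⟩
    ext v
    exact congrArg ξ (congrArg (fun T : E₁ →ₗ[ℂ] E₁ => T v) hs)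
  exact (dualProjL (E := E) (E₁ := E₁) ι).isOpenMap hsurj

variable [LieGroup 𝓘(ℂ, E) ω G] [LieGroup 𝓘(ℂ, E₁) ω G₁]

omit [FiniteDimensional ℂ E] in
lemma mdifferentiableAt_mul_left_comp {V : Type*} [NormedAddCommGroup V] [NormedSpace ℂ V]
    {f : V → G} {x : V} (hf : MDifferentiableAt 𝓘(ℂ, V) 𝓘(ℂ, E) f x) (g : G) :
    MDifferentiableAt 𝓘(ℂ, V) 𝓘(ℂ, E) (fun y => g * f y) x :=
  (mdifferentiableAt_mul_left g (f x)).comp x hf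

omit [FiniteDimensional ℂ E] [FiniteDimensional ℂ E₁] in
/-- The left logarithmic derivative of a product `ι(ρ₁ ∘ p) C`. -/
lemma modelDeriv_log_mul (hι : ContMDiff 𝓘(ℂ, E₁) 𝓘(ℂ, E) ω (fun y => ι y))
    {C : StrongDual ℂ E → G} {ρ₁ : StrongDual ℂ E₁ → G₁} {x : StrongDual ℂ E}
    (hC : MDifferentiableAt 𝓘(ℂ, StrongDual ℂ E) 𝓘(ℂ, E) C x)
    (hρ₁ : MDifferentiableAt 𝓘(ℂ, StrongDual ℂ E₁) 𝓘(ℂ, E₁) ρ₁ (dualProjL ι x)) :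
    (modelDeriv (fun y => (ι (ρ₁ (dualProjL ι x)) * C x)⁻¹ * (ι (ρ₁ (dualProjL ι y)) * C y)) x :
      StrongDual ℂ E →L[ℂ] E) =
    (modelAd E (C x)⁻¹).comp ((modelLieMap E E₁ ι).comp
      ((modelDeriv (fun η => (ρ₁ (dualProjL ι x))⁻¹ * ρ₁ η) (dualProjL ι x) :
        StrongDual ℂ E₁ →L[ℂ] E₁).comp (dualProjL ι))) +
      modelDeriv (fun y => (C x)⁻¹ * C y) x := by
  set p := dualProjL (E := E) (E₁ := E₁) ι with hp
  have hpd : MDifferentiableAt 𝓘(ℂ, StrongDual ℂ E) 𝓘(ℂ, StrongDual ℂ E₁) (fun y => p y) x :=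
    p.differentiableAt.mdifferentiableAt
  have hpder : modelDeriv (fun y => p y) x = p := by
    refine Eq.trans ?_ (p.hasFDerivAt (x := x)).fderiv
    exact mfderiv_eq_fderiv
  have hι1 : MDifferentiableAt 𝓘(ℂ, E₁) 𝓘(ℂ, E) (fun y => ι y) 1 :=
    (hι 1).mdifferentiableAt (by simp)
  have d1 : MDifferentiableAt 𝓘(ℂ, StrongDual ℂ E₁) 𝓘(ℂ, E₁)
      (fun η => (ρ₁ (p x))⁻¹ * ρ₁ η) (p x) := mdifferentiableAt_mul_left_comp hρ₁ _
  have e1 := modelDeriv_comp (f := fun y => p y) (g := fun η => (ρ₁ (p x))⁻¹ * ρ₁ η) rfl d1 hpd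
  have d2 : MDifferentiableAt 𝓘(ℂ, StrongDual ℂ E) 𝓘(ℂ, E₁)
      (fun y => (ρ₁ (p x))⁻¹ * ρ₁ (p y)) x := d1.comp x hpd
  have e2 := modelDeriv_comp (f := fun y => (ρ₁ (p x))⁻¹ * ρ₁ (p y)) (g := fun a => ι a) (y := 1)
    (by simp) hι1 d2
  have d3 : MDifferentiableAt 𝓘(ℂ, StrongDual ℂ E) 𝓘(ℂ, E)
      (fun y => ι ((ρ₁ (p x))⁻¹ * ρ₁ (p y))) x :=
    ((hι _).mdifferentiableAt (by simp)).comp x d2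
  have e3 := modelDeriv_comp (f := fun y => ι ((ρ₁ (p x))⁻¹ * ρ₁ (p y)))
    (g := fun a => (C x)⁻¹ * a * (C x)⁻¹⁻¹) (y := 1) (by simp)
    (mdifferentiableAt_conj (E := E) (C x)⁻¹ 1) d3
  have d4 : MDifferentiableAt 𝓘(ℂ, StrongDual ℂ E) 𝓘(ℂ, E)
      (fun y => (C x)⁻¹ * ι ((ρ₁ (p x))⁻¹ * ρ₁ (p y)) * (C x)⁻¹⁻¹) x :=
    (mdifferentiableAt_conj (E := E) (C x)⁻¹ _).comp x d3
  have e4 := modelDeriv_mul_of_eq_one d4 (mdifferentiableAt_mul_left_comp hC (C x)⁻¹) (by simp)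
    (by simp)
  -- With values at $x$ unprimed and at $y$ primed,
  -- $(\rho_1C)^{-1}\rho_1'C'=\bigl(C^{-1}(\rho_1^{-1}\rho_1')C\bigr)(C^{-1}C')$, a product of two
  -- maps equal to $1$ at $y=x$.
  have hfun : (fun y => (ι (ρ₁ (p x)) * C x)⁻¹ * (ι (ρ₁ (p y)) * C y)) =
      fun y => (C x)⁻¹ * ι ((ρ₁ (p x))⁻¹ * ρ₁ (p y)) * (C x)⁻¹⁻¹ * ((C x)⁻¹ * C y) := by
    funext y
    rw [map_mul, map_inv]
    group
  rw [hfun, e4, e3, e2, e1, hpder]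
  rfl

lemma lieLogDeriv_mul (hι : ContMDiff 𝓘(ℂ, E₁) 𝓘(ℂ, E) ω (fun y => ι y))
    {C : StrongDual ℂ E → G} {ρ₁ : StrongDual ℂ E₁ → G₁} {x : StrongDual ℂ E}
    (hC : MDifferentiableAt 𝓘(ℂ, StrongDual ℂ E) 𝓘(ℂ, E) C x)
    (hρ₁ : MDifferentiableAt 𝓘(ℂ, StrongDual ℂ E₁) 𝓘(ℂ, E₁) ρ₁ (dualProj (G := G) ι x)) :
    lieLogDeriv (fun y => ι (ρ₁ (dualProj (G := G) ι y)) * C y) x =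
      ((Ad (C x)⁻¹).toLinearMap ∘ₗ (lieMap ι).toLinearMap) ∘ₗ
        lieLogDeriv ρ₁ (dualProj (G := G) ι x) ∘ₗ (lieMap ι).toLinearMap.dualMap +
      lieLogDeriv C x := by
  have h := modelDeriv_log_mul hι hC hρ₁
  ext α
  exact congrArg (fun T : StrongDual ℂ E →L[ℂ] E => T (dualEquiv E G α)) h

omit [FiniteDimensional ℂ E] [FiniteDimensional ℂ E₁] [LieGroup 𝓘(ℂ, E) ω G]
  [LieGroup 𝓘(ℂ, E₁) ω G₁] in
lemma lieMap2_injective (hι : Function.Injective (lieMap (E := E) (E₁ := E₁) ι)) :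
    Function.Injective (lieMap2 (E := E) (E₁ := E₁) ι) := by
  have hker : LinearMap.ker (lieMap (E := E) (E₁ := E₁) ι).toLinearMap = ⊥ :=
    LinearMap.ker_eq_bot.mpr hι
  obtain ⟨s, hs⟩ := LinearMap.exists_leftInverse_of_injective _ hker
  refine Function.LeftInverse.injective (g := TensorProduct.map s s) fun z => ?_
  rw [lieMap2, ← LinearMap.comp_apply, ← TensorProduct.map_comp, hs, TensorProduct.map_id,
    LinearMap.id_apply]

omit [FiniteDimensional ℂ E] [FiniteDimensional ℂ E₁] in
lemma Ad2_lieMap2 (hι : MDifferentiableAt 𝓘(ℂ, E₁) 𝓘(ℂ, E) (fun y => ι y) 1) (a : G₁)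
    (z : LieAlg E₁ G₁ ⊗[ℂ] LieAlg E₁ G₁) :
    Ad2 (ι a) (lieMap2 (E := E) ι z) = lieMap2 (E := E) ι (Ad2 a z) := by
  have h : ∀ v : LieAlg E₁ G₁, Ad (ι a) (lieMap (E := E) ι v) = lieMap (E := E) ι (Ad a v) :=
    fun v => (congrArg (fun T : E₁ →L[ℂ] E => T v) (lieMap_Ad hι a)).symm
  induction z with
  | zero => simp
  | tmul b c =>
    change Ad (ι a) (lieMap (E := E) ι b) ⊗ₜ[ℂ] Ad (ι a) (lieMap (E := E) ι c) =
      lieMap (E := E) ι (Ad a b) ⊗ₜ[ℂ] lieMap (E := E) ι (Ad a c)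
    rw [h, h]
  | add b c hb hc => simp only [map_add, hb, hc]

lemma gaugeTransform_eq (ρ : StrongDual ℂ E → G) (r : LieAlg E G ⊗[ℂ] LieAlg E G)
    (x : StrongDual ℂ E) :
    gaugeTransform ρ r x =
      gaugePart (toDual E G x) (lieLogDeriv ρ x) + Ad2 (ρ x)⁻¹ r := by
  simp only [gaugeTransform, gaugePart]
  abel

/-- The gauge transform by a product `ι(ρ₁ ∘ p) C`, where `C` is infinitesimally equivariant and
`r - r₁` is invariant under `G₁`. -/
lemma gaugeTransform_mul (hι : ContMDiff 𝓘(ℂ, E₁) 𝓘(ℂ, E) ω (fun y => ι y))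
    {C : StrongDual ℂ E → G} {ρ₁ : StrongDual ℂ E₁ → G₁} {x : StrongDual ℂ E}
    (hC : MDifferentiableAt 𝓘(ℂ, StrongDual ℂ E) 𝓘(ℂ, E) C x)
    (hρ₁ : MDifferentiableAt 𝓘(ℂ, StrongDual ℂ E₁) 𝓘(ℂ, E₁) ρ₁ (dualProj (G := G) ι x))
    (hequiv : ∀ u : LieAlg E₁ G₁,
      lieLogDeriv C x (coad (lieMap ι u) (toDual E G x)) =
        Ad (C x)⁻¹ (lieMap ι u) - lieMap ι u)
    {r : LieAlg E G ⊗[ℂ] LieAlg E G} {r₁ : LieAlg E₁ G₁ ⊗[ℂ] LieAlg E₁ G₁}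
    (hr : ∀ a : G₁, Ad2 (ι a) (r - lieMap2 ι r₁) = r - lieMap2 ι r₁) :
    gaugeTransform (fun y => ι (ρ₁ (dualProj (G := G) ι y)) * C y) r x =
      gaugeTransform C (r - lieMap2 ι r₁) x +
        Ad2 (C x)⁻¹ (lieMap2 ι (gaugeTransform ρ₁ r₁ (dualProj (G := G) ι x))) := by
  have hι1 : MDifferentiableAt 𝓘(ℂ, E₁) 𝓘(ℂ, E) (fun y => ι y) 1 :=
    (hι 1).mdifferentiableAt (by simp)
  have hmap : ∀ z : LieAlg E₁ G₁ ⊗[ℂ] LieAlg E₁ G₁,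
      TensorProduct.map ((Ad (E := E) (C x)⁻¹).toLinearMap ∘ₗ (lieMap ι).toLinearMap)
        ((Ad (E := E) (C x)⁻¹).toLinearMap ∘ₗ (lieMap ι).toLinearMap) z =
        Ad2 (C x)⁻¹ (lieMap2 ι z) := fun z => by
    rw [TensorProduct.map_comp]
    rfl
  have hpart := gaugePart_add (L := LieAlg E G) (L₁ := LieAlg E₁ G₁) (lieMap ι).toLinearMap
    (lieMap_lie (E := E) hι1)
    (Ad (C x)⁻¹).toLinearMap (toDual E G x) (lieLogDeriv ρ₁ (dualProj (G := G) ι x))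
    (lieLogDeriv C x) hequiv
  have hdual : (lieMap ι).toLinearMap.dualMap (toDual E G x) =
      toDual E₁ G₁ (dualProj (G := G) ι x) := rfl
  -- Split $r=(r-r_1)+r_1$: the first summand is fixed by $\rho_1^{-1}$, and on the second the
  -- adjoint action is that of $G_1$.
  have hAd : Ad2 (ι (ρ₁ (dualProj (G := G) ι x)) * C x)⁻¹ r =
      Ad2 (C x)⁻¹ (r - lieMap2 ι r₁) +
        Ad2 (C x)⁻¹ (lieMap2 ι (Ad2 (ρ₁ (dualProj (G := G) ι x))⁻¹ r₁)) := by
    rw [mul_inv_rev, Ad2_mul_apply, ← map_inv, ← map_add]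
    congr 1
    conv_lhs => rw [← sub_add_cancel r (lieMap2 ι r₁)]
    rw [map_add, hr, Ad2_lieMap2 hι1]
  rw [gaugeTransform_eq, gaugeTransform_eq, gaugeTransform_eq, lieLogDeriv_mul hι hC hρ₁, hpart,
    hmap, hAd, hdual, map_add, map_add]
  abel

lemma leviDerived_le_levi {L : Type*} [LieRing L] [LieAlgebra ℂ L] (lam : L) :
    leviDerived lam ≤ levi lam := by
  refine Submodule.span_le.mpr ?_
  rintro _ ⟨u, hu, v, hv, rfl⟩
  have hu' : ⁅lam, u⁆ = 0 := hu
  have hv' : ⁅lam, v⁆ = 0 := hv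
  change ⁅lam, ⁅u, v⁆⁆ = 0
  rw [leibniz_lie, hu', hv', zero_lie, lie_zero, add_zero]

end Group

end GWTwist

end

/-! ### The equivalence -/

open GWTwist
set_option maxHeartbeats 1000000 in
theorem proposition6p7
    {E : Type*} [NormedAddCommGroup E] [NormedSpace ℂ E] [FiniteDimensional ℂ E]
    {G : Type*} [TopologicalSpace G] [ChartedSpace E G] [Group G] [LieGroup 𝓘(ℂ, E) ω G]
    -- the Lie algebra of `G` is reductive
    [LieAlgebra.HasCentralRadical ℂ (LieAlg E G)]
    (B : LinearMap.BilinForm ℂ (LieAlg E G)) (hB : IsInvariantForm B)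
    (t : LieSubalgebra ℂ (LieAlg E G)) [t.IsCartanSubalgebra]
    (P : Finset (Module.Dual ℂ t)) (hP : IsPositiveSystem t P)
    -- `θ` is a direction in the chosen sector: positive roots `α` with `α lam ≠ 0` are those
    -- with `α lam` in the half-plane counterclockwise from `θ`
    (lam : t) (θ : ℂ) (hθ : ∀ α ∈ P, α lam ≠ 0 → 0 < (α lam / θ).im)
    (e : Module.Dual ℂ t → LieAlg E G) (he : IsRootVectors B t e)
    -- the connected group `G₁` integrating `𝔤₁ = [𝔥, 𝔥]`
    {E₁ : Type*} [NormedAddCommGroup E₁] [NormedSpace ℂ E₁] [FiniteDimensional ℂ E₁]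
    {G₁ : Type*} [TopologicalSpace G₁] [ChartedSpace E₁ G₁] [Group G₁]
    [LieGroup 𝓘(ℂ, E₁) ω G₁] [ConnectedSpace G₁]
    (ι : G₁ →* G) (hι : ContMDiff 𝓘(ℂ, E₁) 𝓘(ℂ, E) ω (fun y => ι y))
    (hι_inj : Function.Injective (lieMap (E := E) (E₁ := E₁) ι))
    (hι_range : LinearMap.range (lieMap (E := E) (E₁ := E₁) ι).toLinearMap
      = leviDerived (lam : LieAlg E G))
    -- the root vectors of `𝔥`, as elements of `𝔤₁`
    (e₁ : Module.Dual ℂ t → LieAlg E₁ G₁)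
    (he₁ : ∀ α ∈ roots t, α lam = 0 → lieMap (E := E) ι (e₁ α) = e α)
    (D : Set (StrongDual ℂ E)) (hD : IsOpen D)
    (hD_am : ∀ x ∈ D, toDual E G x ∈ amDomain B ∧
      toDual E₁ G₁ (dualProj (G := G) ι x) ∈ amDomain (formRestrict B ι))
    (C : StrongDual ℂ E → G)
    (hC : IsRelativeTwist B (lam : LieAlg E G) ι (standardR P e)
      (standardR (leviPos P lam) e₁) D C)
    (ρ₁ : StrongDual ℂ E₁ → G₁)
    (hρ₁ : MDifferentiableOn 𝓘(ℂ, StrongDual ℂ E₁) 𝓘(ℂ, E₁) ρ₁ (dualProj (G := G) ι '' D)) :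
    (∀ ξ ∈ dualProj (G := G) ι '' D,
        gaugeTransform ρ₁ (standardR (leviPos P lam) e₁) ξ
          = rAM (formRestrict B ι) (toDual E₁ G₁ ξ)) ↔
      (∀ x ∈ D,
        gaugeTransform (fun y => ι (ρ₁ (dualProj (G := G) ι y)) * C y) (standardR P e) x
          = rAM B (toDual E G x)) := by
  have hι1 : MDifferentiableAt 𝓘(ℂ, E₁) 𝓘(ℂ, E) (fun y => ι y) 1 :=
    (hι 1).mdifferentiableAt (by simp)
  have hlevi : ∀ u : LieAlg E₁ G₁, lieMap (E := E) ι u ∈ levi (lam : LieAlg E G) := fun u => by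
    refine leviDerived_le_levi (L := LieAlg E G) _ ?_
    rw [← hι_range]
    exact ⟨u, rfl⟩
  have hr₁ : lieMap2 ι (standardR (leviPos P lam) e₁) = standardR (leviPos P lam) e := by
    simp only [standardR, map_sum]
    refine Finset.sum_congr rfl fun α hα => ?_
    obtain ⟨hαP, hα0⟩ := Finset.mem_filter.mp hα
    have hαr := hP.subset_roots α hαP
    have h1 := he₁ α hαr hα0
    -- The negative root also vanishes on `lam`, so both factors of the wedge come from $\mathfrak
    -- g_1$.
    have h2 := he₁ (-α) (he.neg_mem_roots hB hαr) (by rw [LinearMap.neg_apply, hα0, neg_zero])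
    rw [← h1, ← h2, wedge, wedge, map_smul, map_sub]
    rfl
  have hr : standardR P e - lieMap2 (E := E) ι (standardR (leviPos P lam) e₁) =
      standardR (nilradPos P lam) e := by
    rw [hr₁, standardR_eq_add P lam e, add_sub_cancel_right]
  have hinv : ∀ a : G₁,
      Ad2 (ι a) (standardR P e - lieMap2 ι (standardR (leviPos P lam) e₁)) =
        standardR P e - lieMap2 ι (standardR (leviPos P lam) e₁) := by
    rw [hr]
    exact Ad2_eq_self_of_adTensor_eq_zero hι fun u =>
      adTensor_standardR_eq_zero hB he hP hθ (hlevi u)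
  have hopen : IsOpen (dualProj (G := G) ι '' D) := isOpenMap_dualProj hι_inj D hD
  -- The product formula minus the twist equation: the two defects differ by an injective linear
  -- map.
  have hmain : ∀ x ∈ D,
      gaugeTransform (fun y => ι (ρ₁ (dualProj (G := G) ι y)) * C y) (standardR P e) x -
        rAM B (toDual E G x) =
      Ad2 (C x)⁻¹ (lieMap2 ι
        (gaugeTransform ρ₁ (standardR (leviPos P lam) e₁) (dualProj (G := G) ι x) -
          rAM (formRestrict B ι) (toDual E₁ G₁ (dualProj (G := G) ι x)))) := by
    intro x hx
    rw [gaugeTransform_mul hι (hC.holomorphic.mdifferentiableAt (hD.mem_nhds hx))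
      (hρ₁.mdifferentiableAt (hopen.mem_nhds ⟨x, hx, rfl⟩))
      (fun u => hC.equivariant x hx _ (hlevi u)) hinv, ← hC.gauge_eq x hx, map_sub, map_sub]
    abel
  constructor
  · intro h x hx
    rw [← sub_eq_zero, hmain x hx, h _ ⟨x, hx, rfl⟩, sub_self, map_zero, map_zero]
  · rintro h _ ⟨x, hx, rfl⟩
    have h0 := hmain x hx
    rw [h x hx, sub_self] at h0
    refine sub_eq_zero.mp (lieMap2_injective hι_inj (Ad2_injective (C x)⁻¹ ?_))
    rw [← h0, map_zero, map_zero]
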